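/- Let $p$ be a prime, $G$ a finite group and $k$ a field of characteristic $p$. For $H\le G$, a block idempotent of $kH$ is a primitive idempotent of the center $Z(kH)$. For a $p$-subgroup $P\le G$ let $\mathrm{Br}_P\colon (kG)^P\to kC_G(P)$, $\sum_{g\in G}\alpha_g g\mapsto\sum_{g\in C_G(P)}\alpha_g g$, be the Brauer homomorphism. A $kG$-Brauer pair $(P,e)$ consists of a $p$-subgroup $P\le G$ and a block idempotent $e$ of $kC_G(P)$; for a block idempotent $b$ of $kG$ it is a $(kG,b)$-Brauer pair if $\mathrm{Br}_P(b)e=e$. One writes $(Q,f)\le(P,e)$ if $Q\le P$ and every primitive idempotent $i$ of $(kG)^P$ with $e\,\mathrm{Br}_P(i)=\mathrm{Br}_P(i)\ne0$ also satisfies $f\,\mathrm{Br}_Q(i)=\mathrm{Br}_Q(i)\ne0$. For a maximal $(kG,b)$-Brauer pair $(P,e)$ and $Q\le P$, let $e_Q$ be the unique block idempotent of $kC_G(Q)$ with $(Q,e_Q)\le(P,e)$. The fusion system $\mathcal{F}_{(P,e)}(kGb)$ over $P$ is the category whose objects are the subgroups of $P$ and in which the morphisms $Q\to R$ are the group homomorphisms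 $\varphi\colon Q\to R$ for which there is $x\in G$ with $\varphi(u)=xux^{-1}$ for all $u\in Q$ and $(xQx^{-1},xe_Qx^{-1})\le(R,e_R)$. For such a category $\mathcal{E}$ over $P$, a subgroup $Q\le P$ is called fully $\mathcal{E}$-centralized (respectively fully $\mathcal{E}$-normalized) if $|C_P(Q)|\ge|C_P(Q')|$ (respectively $|N_P(Q)|\ge|N_P(Q')|$) for every $Q'\le P$ that is $\mathcal{E}$-isomorphic to $Q$, and $\mathcal{E}$-centric if $C_P(R)=Z(R)$ for every $R\le P$ that is $\mathcal{E}$-isomorphic to $Q$. **Proposition 6.1.** Let $L/K$ be a finite Galois extension of fields of characteristic $p$ with Galois group $\Gamma$, which acts on $LG$ through the coefficients. Let $b$ be a block idempotent of $LG$ and let $(P,e)$ be a maximal $(LG,b)$-Brauer pair. Let $\tilde b\in KG$ and $\tilde e\in KC_G(P)$ denote the sums of the distinct $\Gamma$-conjugates of $b$ and of $e$, respectively (it is known that $\tilde b$ is a block idempotent of $KG$ and that $(P,\tilde e)$ is a maximal $(KG,\tilde b)$-Brauer pair). Set $\mathcal{F}:=\mathcal{F}_{(P,e)}(LGb)$ and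 $\tilde{\mathcal{F}}:=\mathcal{F}_{(P,\tilde e)}(KG\tilde b)$. Then for every subgroup $Q$ of $P$: (a) $Q$ is fully $\mathcal{F}$-centralized if and only if it is fully $\tilde{\mathcal{F}}$-centralized; (b) $Q$ is fully $\mathcal{F}$-normalized if and only if it is fully $\tilde{\mathcal{F}}$-normalized; (c) $Q$ is $\mathcal{F}$-centric if and only if it is $\tilde{\mathcal{F}}$-centric. -/

import Mathlib

/-!
Group algebras over a finite group `G`. For `H ≤ G` the group algebra `kH` is identified with the
subalgebra of `kG` of all elements supported on `H`.
-/

section Fusion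

/-- A family of sets of homomorphisms between the subgroups of a group `P`: the morphism sets of a
category whose objects are the subgroups of `P` and whose morphisms are group homomorphisms (with
the usual composition). -/
def SubgroupHoms (P : Type*) [Group P] : Type _ :=
  ∀ Q R : Subgroup P, Set (Q →* R)

namespace SubgroupHoms

variable {P : Type*} [Group P] (F : SubgroupHoms P)

/-- `Q` and `R` are `F`-isomorphic: there is an isomorphism `Q → R` which, together with its
inverse, is a morphism of `F`. -/
def Isomorphic (Q R : Subgroup P) : Prop :=
  ∃ φ : Q ≃* R, φ.toMonoidHom ∈ F Q R ∧ φ.symm.toMonoidHom ∈ F R Q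

/-- `Q` is fully `F`-centralized: `|C_P(Q)| ≥ |C_P(Q')|` for all `Q'` that are `F`-isomorphic
to `Q`. -/
def FullyCentralized (Q : Subgroup P) : Prop :=
  ∀ Q' : Subgroup P, F.Isomorphic Q Q' →
    Nat.card (Subgroup.centralizer (Q' : Set P)) ≤ Nat.card (Subgroup.centralizer (Q : Set P))

/-- `Q` is fully `F`-normalized: `|N_P(Q)| ≥ |N_P(Q')|` for all `Q'` that are `F`-isomorphic
to `Q`. -/
def FullyNormalized (Q : Subgroup P) : Prop :=
  ∀ Q' : Subgroup P, F.Isomorphic Q Q' →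
    Nat.card (Subgroup.normalizer (Q' : Set P)) ≤ Nat.card (Subgroup.normalizer (Q : Set P))

/-- `Q` is `F`-centric: `C_P(R) = Z(R)` for all `R` that are `F`-isomorphic to `Q`. -/
def Centric (Q : Subgroup P) : Prop :=
  ∀ R : Subgroup P, F.Isomorphic Q R →
    Subgroup.centralizer (R : Set P) = (Subgroup.center R).map R.subtype

end SubgroupHoms

end Fusion

section Blocks

/-- `i` is a primitive idempotent of the subalgebra `S` of `A`: a non-zero idempotent of `S` that
is not a sum of two non-zero orthogonal idempotents of `S`. -/
def IsPrimitiveIdempotentIn {k A : Type*} [CommSemiring k] [Semiring A] [Algebra k A]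
    (S : Subalgebra k A) (i : A) : Prop :=
  i ∈ S ∧ IsIdempotentElem i ∧ i ≠ 0 ∧
    ∀ i₁ ∈ S, ∀ i₂ ∈ S, IsIdempotentElem i₁ → IsIdempotentElem i₂ →
      i₁ * i₂ = 0 → i₂ * i₁ = 0 → i₁ + i₂ = i → i₁ = 0 ∨ i₂ = 0

variable (k : Type*) [Field k] {G : Type*} [Group G]

/-- The `k`-linear extension `c_x : kG → kG` of the conjugation `g ↦ x g x⁻¹`. -/
noncomputable def conjAlg (x : G) : MonoidAlgebra k G ≃ₐ[k] MonoidAlgebra k G :=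
  MonoidAlgebra.domCongr k k (MulAut.conj x)

/-- The group algebra `kH` inside `kG`. -/
noncomputable def groupSubalgebra (H : Subgroup G) : Subalgebra k (MonoidAlgebra k G) :=
  (MonoidAlgebra.mapDomainAlgHom k k H.subtype).range

/-- The center `Z(kH)` inside `kG`. -/
noncomputable def centerSubalgebra (H : Subgroup G) : Subalgebra k (MonoidAlgebra k G) :=
  groupSubalgebra k H ⊓ Subalgebra.centralizer k (groupSubalgebra k H : Set (MonoidAlgebra k G))

theorem groupSubalgebra_top : groupSubalgebra k (⊤ : Subgroup G) = ⊤ := by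
  rw [groupSubalgebra, AlgHom.range_eq_top]
  intro a
  induction a using MonoidAlgebra.induction_linear with
  | zero => exact ⟨0, map_zero _⟩
  | add x y hx hy =>
    obtain ⟨x, rfl⟩ := hx
    obtain ⟨y, rfl⟩ := hy
    exact ⟨x + y, map_add _ _ _⟩
  | single m r => exact ⟨.single ⟨m, trivial⟩ r, by simp⟩

theorem centerSubalgebra_top :
    centerSubalgebra k (⊤ : Subgroup G) = Subalgebra.center k (MonoidAlgebra k G) := by
  simp [centerSubalgebra, groupSubalgebra_top]

/-- The algebra `(kG)^P` of fixed points under conjugation by `P`. -/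
noncomputable def fixedSubalgebra (P : Subgroup G) : Subalgebra k (MonoidAlgebra k G) where
  carrier := {a | ∀ x ∈ P, conjAlg k x a = a}
  mul_mem' := fun ha hb x hx => by rw [map_mul, ha x hx, hb x hx]
  add_mem' := fun ha hb x hx => by rw [map_add, ha x hx, hb x hx]
  algebraMap_mem' := fun r x _ => AlgEquiv.commutes _ r

variable {k}

/-- `e` is a block idempotent of `kH`: a primitive idempotent of `Z(kH)`. -/
def IsBlockIdempotent (H : Subgroup G) (e : MonoidAlgebra k G) : Prop :=
  IsPrimitiveIdempotentIn (centerSubalgebra k H) e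

open Classical in
/-- The `k`-linear projection `kG → kC_G(P)`, `∑ α_g g ↦ ∑_{g ∈ C_G(P)} α_g g`. Its restriction to
`(kG)^P` is the Brauer homomorphism `Br_P`. -/
noncomputable def brauerMap (P : Subgroup G) (a : MonoidAlgebra k G) : MonoidAlgebra k G :=
  .ofCoeff (a.coeff.filter (fun g => g ∈ Subgroup.centralizer (P : Set G)))

/-- `(P, e)` is a `kG`-Brauer pair: `P` is a `p`-subgroup of `G` and `e` is a block idempotent of
`kC_G(P)`. -/
def IsBrauerPair (p : ℕ) (P : Subgroup G) (e : MonoidAlgebra k G) : Prop :=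
  IsPGroup p P ∧ IsBlockIdempotent (Subgroup.centralizer (P : Set G)) e

/-- `(P, e)` is a `(kG, b)`-Brauer pair: a `kG`-Brauer pair with `Br_P(b) e = e`. -/
def IsBrauerPairOf (p : ℕ) (b : MonoidAlgebra k G) (P : Subgroup G) (e : MonoidAlgebra k G) :
    Prop :=
  IsBrauerPair p P e ∧ brauerMap P b * e = e

/-- The idempotent `i` of `(kG)^P` is associated to `(P, e)`: `e Br_P(i) = Br_P(i) ≠ 0`. -/
def IsAssociated (i : MonoidAlgebra k G) (P : Subgroup G) (e : MonoidAlgebra k G) : Prop :=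
  e * brauerMap P i = brauerMap P i ∧ brauerMap P i ≠ 0

/-- The relation `(Q, f) ≤ (P, e)` on `kG`-Brauer pairs: `Q ≤ P` and every primitive idempotent of
`(kG)^P` associated to `(P, e)` is associated to `(Q, f)`. -/
def BrauerPairLE (Q : Subgroup G) (f : MonoidAlgebra k G) (P : Subgroup G)
    (e : MonoidAlgebra k G) : Prop :=
  Q ≤ P ∧ ∀ i : MonoidAlgebra k G, IsPrimitiveIdempotentIn (fixedSubalgebra k P) i →
    IsAssociated i P e → IsAssociated i Q f

/-- `(P, e)` is a maximal `(kG, b)`-Brauer pair. -/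
def IsMaximalBrauerPairOf (p : ℕ) (b : MonoidAlgebra k G) (P : Subgroup G)
    (e : MonoidAlgebra k G) : Prop :=
  IsBrauerPairOf p b P e ∧
    ∀ (Q : Subgroup G) (f : MonoidAlgebra k G), IsBrauerPairOf p b Q f →
      BrauerPairLE P e Q f → Q = P ∧ f = e

/-- `f` is the block idempotent `e_Q` of `kC_G(Q)`, i.e. `(Q, f)` is a `kG`-Brauer pair with
`(Q, f) ≤ (P, e)`. -/
def IsBlockBelow (p : ℕ) (P : Subgroup G) (e : MonoidAlgebra k G) (Q : Subgroup G)
    (f : MonoidAlgebra k G) : Prop :=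
  IsBrauerPair p Q f ∧ BrauerPairLE Q f P e

/-- The fusion system of the maximal `(kG, b)`-Brauer pair `(P, e)`. For `Q, R ≤ P`, a homomorphism
`φ : Q → R` is a morphism if there is `x ∈ G` with `φ(u) = x u x⁻¹` for all `u ∈ Q` and
`(x Q x⁻¹, x e_Q x⁻¹) ≤ (R, e_R)`. The block idempotent `b` is determined by `(P, e)` and does not
enter otherwise. -/
def blockFusion (p : ℕ) (P : Subgroup G) (e : MonoidAlgebra k G) : SubgroupHoms P :=
  fun Q R => {φ | ∃ x : G, (∀ u : Q, ((φ u : P) : G) = x * ((u : P) : G) * x⁻¹) ∧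
    ∃ eQ eR : MonoidAlgebra k G,
      IsBlockBelow p P e (Q.map P.subtype) eQ ∧ IsBlockBelow p P e (R.map P.subtype) eR ∧
      BrauerPairLE ((Q.map P.subtype).map (MulAut.conj x).toMonoidHom) (conjAlg k x eQ)
        (R.map P.subtype) eR}

end Blocks

section Galois

variable (K : Type*) {L G : Type*} [Field K] [Field L] [Algebra K L]

/-- The sum of the distinct Galois conjugates of `a ∈ LG`, where the Galois group acts on
coefficients. -/
noncomputable def orbitSum (a : MonoidAlgebra L G) : MonoidAlgebra L G :=
  ∑ᶠ c ∈ MulAction.orbit (L ≃ₐ[K] L) a, c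

theorem smul_orbitSum [FiniteDimensional K L] (γ : L ≃ₐ[K] L) (a : MonoidAlgebra L G) :
    γ • orbitSum K a = orbitSum K a := by
  have hfin : (MulAction.orbit (L ≃ₐ[K] L) a).Finite := Set.finite_range _
  unfold orbitSum
  rw [smul_finsum_mem hfin]
  refine finsum_mem_eq_of_bijOn (fun c => γ • c) ⟨?_, (MulAction.injective γ).injOn, ?_⟩
    (fun _ _ => rfl)
  · rintro _ ⟨δ, rfl⟩
    exact ⟨γ * δ, mul_smul γ δ a⟩
  · rintro _ ⟨δ, rfl⟩
    exact ⟨γ⁻¹ • δ • a, ⟨γ⁻¹ * δ, mul_smul γ⁻¹ δ a⟩, smul_inv_smul γ (δ • a)⟩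

variable [Group G]

theorem exists_map_eq_orbitSum [FiniteDimensional K L] [IsGalois K L] (a : MonoidAlgebra L G) :
    ∃ c : MonoidAlgebra K G, MonoidAlgebra.mapRingHom G (algebraMap K L) c = orbitSum K a := by
  have hinv : Function.LeftInverse (Function.invFun (algebraMap K L)) (algebraMap K L) :=
    Function.leftInverse_invFun (algebraMap K L).injective
  have h0 : Function.invFun (algebraMap K L) 0 = 0 := by
    simpa using hinv 0
  refine ⟨.ofCoeff ((orbitSum K a).coeff.mapRange _ h0), ?_⟩
  ext g
  obtain ⟨x, hx⟩ := (IsGalois.mem_range_algebraMap_iff_fixed (F := K)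
    ((orbitSum K a).coeff g)).2 (fun γ => by
      have := congrArg (fun c : MonoidAlgebra L G => c.coeff g) (smul_orbitSum K γ a)
      simpa using this)
  simp [← hx, hinv x]

/-- `ã ∈ KG`: the sum of the distinct Galois conjugates of `a ∈ LG`, which has coefficients
in `K`. -/
noncomputable def tilde [FiniteDimensional K L] [IsGalois K L] (a : MonoidAlgebra L G) :
    MonoidAlgebra K G :=
  (exists_map_eq_orbitSum K a).choose

theorem map_tilde [FiniteDimensional K L] [IsGalois K L] (a : MonoidAlgebra L G) :
    MonoidAlgebra.mapRingHom G (algebraMap K L) (tilde K a) = orbitSum K a :=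
  (exists_map_eq_orbitSum K a).choose_spec

end Galois

/-! Write `F` for the fusion system over `L` and `F'` for the one over `K`. Every `F`-isomorphism is
an `F'`-isomorphism, and if `Q` and `R` are `F'`-isomorphic then `Q` is `F`-isomorphic to `α(R)` for
some automorphism `α` of `P`. An automorphism preserves the orders of centralizers and normalizers
and the condition `C_P(R) ≤ R`, so testing all `F'`-isomorphic copies of `Q` amounts to testing the
`F`-isomorphic ones. This gives (a), (b) and (c) together.

The first inclusion holds because orbit sums are compatible with inclusion of Brauer pairs: if `f`
is the block below `(P, e)` at `Q`, then `tilde K f` is the block below `(P, tilde K e)` at `Q`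
(`IsBlockBelow.isBlockBelow_tilde`).

For the converse, let `x` induce an `F'`-isomorphism `Q → R`, and let `f`, `g` be the blocks below
`(P, e)` at `Q`, `R`. Then `x` sends the orbit sum of `f` to that of `g`, so `x f x⁻¹ = σ g` for
some Galois automorphism `σ`. The pair `(R, σ g)` belongs both to `b` and to `σ b`, hence `σ b = b`,
and `(P, σ e)` is again a `(LG, b)`-Brauer pair. It is therefore conjugate to `(P, e)` by some `y ∈
N_G(P)`. Now `y⁻¹ x` sends `(Q, f)` to a pair below `(P, e)`, and `α` is conjugation by `y⁻¹`.

Two facts of block theory are needed over an arbitrary field of characteristic `p`, so they are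
proved without assuming a splitting field: each subgroup of `P` carries a unique block below `(P,
e)` (`IsBrauerPair.exists_le`, `IsBrauerPair.block_unique`), and maximal `(kG, b)`-Brauer pairs are
conjugate (`IsMaximalBrauerPairOf.exists_conj_eq`). -/

section BrauerMap

/-! ### Conjugation, fixed points and multiplicativity of the Brauer map. -/

open MonoidAlgebra

variable {k : Type*} [Field k] {G : Type*} [Group G]

@[simp]
theorem coeff_conjAlg (x : G) (a : MonoidAlgebra k G) (g : G) :
    (conjAlg k x a).coeff g = a.coeff (x⁻¹ * g * x) := by
  simp [conjAlg, MulAut.conj_symm_apply]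

theorem conjAlg_mul (x y : G) (a : MonoidAlgebra k G) :
    conjAlg k (x * y) a = conjAlg k x (conjAlg k y a) := by
  ext g; simp [mul_assoc]

@[simp]
theorem conjAlg_one (a : MonoidAlgebra k G) : conjAlg k (1 : G) a = a := by
  ext g; simp

@[simp]
theorem conjAlg_inv_conjAlg (x : G) (a : MonoidAlgebra k G) :
    conjAlg k x⁻¹ (conjAlg k x a) = a := by
  rw [← conjAlg_mul]; simp

@[simp]
theorem conjAlg_conjAlg_inv (x : G) (a : MonoidAlgebra k G) :
    conjAlg k x (conjAlg k x⁻¹ a) = a := by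
  rw [← conjAlg_mul]; simp

theorem mem_fixedSubalgebra {P : Subgroup G} {a : MonoidAlgebra k G} :
    a ∈ fixedSubalgebra k P ↔ ∀ x ∈ P, conjAlg k x a = a := Iff.rfl

theorem mem_fixedSubalgebra_iff_coeff {P : Subgroup G} {a : MonoidAlgebra k G} :
    a ∈ fixedSubalgebra k P ↔ ∀ x ∈ P, ∀ g, a.coeff (x * g * x⁻¹) = a.coeff g := by
  rw [mem_fixedSubalgebra]
  constructor
  · intro h x hx g
    have := congrArg (fun c => c.coeff g) (h x⁻¹ (inv_mem hx))
    simpa using this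
  · intro h x hx
    ext g
    simpa using h x⁻¹ (inv_mem hx) g

theorem fixedSubalgebra_anti {P Q : Subgroup G} (h : Q ≤ P) :
    fixedSubalgebra k P ≤ fixedSubalgebra k Q := fun _ ha x hx => ha x (h hx)

theorem mem_groupSubalgebra {H : Subgroup G} {a : MonoidAlgebra k G} :
    a ∈ groupSubalgebra k H ↔ ∀ g, a.coeff g ≠ 0 → g ∈ H := by
  constructor
  · rintro ⟨c, rfl⟩ g hg
    induction c using MonoidAlgebra.induction_linear with
    | zero => simp at hg
    | add x y hx hy =>
      by_contra hgH
      have h1 := not_imp_comm.1 hx hgH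
      have h2 := not_imp_comm.1 hy hgH
      rw [map_add, coeff_add, Finsupp.add_apply, h1, h2, add_zero] at hg
      exact hg rfl
    | single m r =>
      classical
      by_contra hgH
      apply hg
      have : (m : G) ≠ g := fun h => hgH (h ▸ m.2)
      simp [this]
  · intro h
    rw [← sum_coeff_single a]
    refine sum_mem fun g hg => ?_
    exact ⟨single ⟨g, h g (Finsupp.mem_support_iff.1 hg)⟩ (a.coeff g), by simp⟩

theorem single_mem_groupSubalgebra {H : Subgroup G} {g : G} (hg : g ∈ H) (r : k) :
    single g r ∈ groupSubalgebra k H := by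
  classical
  rw [mem_groupSubalgebra]
  intro x hx
  have : g = x := by
    by_contra h
    simp [h] at hx
  exact this ▸ hg

theorem conjAlg_eq_mul (x : G) (a : MonoidAlgebra k G) :
    conjAlg k x a = single x 1 * a * single x⁻¹ 1 := by
  ext g; simp [mul_assoc]

theorem commute_of_mem_fixedSubalgebra {H : Subgroup G} {a c : MonoidAlgebra k G}
    (ha : a ∈ fixedSubalgebra k H) (hc : c ∈ groupSubalgebra k H) : a * c = c * a := by
  rw [mem_groupSubalgebra] at hc
  rw [← sum_coeff_single c, Finsupp.sum, Finset.mul_sum, Finset.sum_mul]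
  refine Finset.sum_congr rfl fun g hg => ?_
  have h := ha g (hc g (Finsupp.mem_support_iff.1 hg))
  rw [conjAlg_eq_mul] at h
  have h2 : single g (c.coeff g) = (c.coeff g) • single g (1 : k) := by simp
  rw [h2, mul_smul_comm, smul_mul_assoc]
  congr 1
  conv_lhs => rw [← h]
  simp [mul_assoc, single_mul_single, ← one_def]

theorem mem_centerSubalgebra {H : Subgroup G} {a : MonoidAlgebra k G} :
    a ∈ centerSubalgebra k H ↔ a ∈ groupSubalgebra k H ∧ a ∈ fixedSubalgebra k H := by
  rw [centerSubalgebra, Algebra.mem_inf]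
  refine and_congr_right fun _ => ?_
  rw [Subalgebra.mem_centralizer_iff]
  constructor
  · intro h x hx
    rw [conjAlg_eq_mul, h _ (single_mem_groupSubalgebra hx 1)]
    simp [mul_assoc, single_mul_single, ← one_def]
  · intro h c hc
    exact (commute_of_mem_fixedSubalgebra h hc).symm

theorem conjAlg_mem_groupSubalgebra {H : Subgroup G} {a : MonoidAlgebra k G} (x : G) :
    conjAlg k x a ∈ groupSubalgebra k (H.map (MulAut.conj x).toMonoidHom) ↔
      a ∈ groupSubalgebra k H := by
  simp only [mem_groupSubalgebra, coeff_conjAlg]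
  constructor
  · intro h g hg
    obtain ⟨y, hy, hyg⟩ := h (x * g * x⁻¹) (by simpa [mul_assoc] using hg)
    simp only [MulEquiv.coe_toMonoidHom, MulAut.conj_apply] at hyg
    simpa using (mul_left_cancel (mul_right_cancel hyg)) ▸ hy
  · intro h g hg
    exact ⟨_, h _ hg, by simp [mul_assoc]⟩

theorem conjAlg_mem_fixedSubalgebra {H : Subgroup G} {a : MonoidAlgebra k G} (x : G) :
    conjAlg k x a ∈ fixedSubalgebra k (H.map (MulAut.conj x).toMonoidHom) ↔
      a ∈ fixedSubalgebra k H := by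
  simp only [mem_fixedSubalgebra]
  constructor
  · intro h y hy
    have := h (x * y * x⁻¹) ⟨y, hy, by simp⟩
    rw [← conjAlg_mul] at this
    simp only [inv_mul_cancel_right] at this
    rw [conjAlg_mul] at this
    exact (conjAlg k x).injective this
  · rintro h _ ⟨y, hy, rfl⟩
    simp only [MulEquiv.coe_toMonoidHom, MulAut.conj_apply]
    rw [← conjAlg_mul, inv_mul_cancel_right, conjAlg_mul, h y hy]

open Classical in
@[simp]
theorem coeff_brauerMap (P : Subgroup G) (a : MonoidAlgebra k G) (g : G) :
    (brauerMap P a).coeff g =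
      if g ∈ Subgroup.centralizer (P : Set G) then a.coeff g else 0 := by
  simp [brauerMap, Finsupp.filter_apply]

/-- `brauerMap` as a linear map. -/
noncomputable def brauerLinearMap (P : Subgroup G) :
    MonoidAlgebra k G →ₗ[k] MonoidAlgebra k G where
  toFun := brauerMap P
  map_add' a c := by
    ext g
    simp only [coeff_brauerMap, coeff_add, Finsupp.add_apply]
    split_ifs <;> simp
  map_smul' r a := by
    ext g
    simp only [coeff_brauerMap, coeff_smul_apply, RingHom.id_apply]
    split_ifs <;> simp

theorem brauerMap_add (P : Subgroup G) (a c : MonoidAlgebra k G) :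
    brauerMap P (a + c) = brauerMap P a + brauerMap P c := map_add (brauerLinearMap P) a c

theorem brauerMap_zero (P : Subgroup G) : brauerMap P (0 : MonoidAlgebra k G) = 0 :=
  map_zero (brauerLinearMap P)

theorem brauerMap_sum {ι : Type*} (P : Subgroup G) (s : Finset ι) (a : ι → MonoidAlgebra k G) :
    brauerMap P (∑ i ∈ s, a i) = ∑ i ∈ s, brauerMap P (a i) := map_sum (brauerLinearMap P) a s

theorem brauerMap_mem_groupSubalgebra (P : Subgroup G) (a : MonoidAlgebra k G) :
    brauerMap P a ∈ groupSubalgebra k (Subgroup.centralizer (P : Set G)) := by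
  rw [mem_groupSubalgebra]
  intro g hg
  rw [coeff_brauerMap] at hg
  split_ifs at hg with h
  · exact h
  · exact absurd rfl hg

theorem brauerMap_of_mem {P : Subgroup G} {a : MonoidAlgebra k G}
    (ha : a ∈ groupSubalgebra k (Subgroup.centralizer (P : Set G))) : brauerMap P a = a := by
  rw [mem_groupSubalgebra] at ha
  ext g
  rw [coeff_brauerMap]
  split_ifs with h
  · rfl
  · by_contra h2
    exact h (ha g (Ne.symm h2))

theorem brauerMap_one (P : Subgroup G) : brauerMap P (1 : MonoidAlgebra k G) = 1 :=
  brauerMap_of_mem (one_mem _)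

theorem centralizer_anti {P Q : Subgroup G} (h : Q ≤ P) :
    Subgroup.centralizer (P : Set G) ≤ Subgroup.centralizer (Q : Set G) :=
  Subgroup.centralizer_le h

theorem brauerMap_brauerMap {P Q : Subgroup G} (h : Q ≤ P) (a : MonoidAlgebra k G) :
    brauerMap P (brauerMap Q a) = brauerMap P a := by
  ext g
  simp only [coeff_brauerMap]
  split_ifs with h1 h2
  · rfl
  · exact absurd (centralizer_anti h h1) h2
  · rfl

theorem mem_centralizer_conj_iff {P : Subgroup G} (x g : G) :
    g ∈ Subgroup.centralizer ((P.map (MulAut.conj x).toMonoidHom : Subgroup G) : Set G) ↔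
      x⁻¹ * g * x ∈ Subgroup.centralizer (P : Set G) := by
  simp only [Subgroup.mem_centralizer_iff, SetLike.mem_coe]
  constructor
  · intro h y hy
    have := h (x * y * x⁻¹) ⟨y, hy, by simp⟩
    calc y * (x⁻¹ * g * x) = x⁻¹ * (x * y * x⁻¹ * g) * x := by group
      _ = x⁻¹ * (g * (x * y * x⁻¹)) * x := by rw [this]
      _ = _ := by group
  · rintro h _ ⟨y, hy, rfl⟩
    simp only [MulEquiv.coe_toMonoidHom, MulAut.conj_apply]
    calc x * y * x⁻¹ * g = x * (y * (x⁻¹ * g * x)) * x⁻¹ := by group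
      _ = x * (x⁻¹ * g * x * y) * x⁻¹ := by rw [h y hy]
      _ = _ := by group

theorem conjAlg_brauerMap (x : G) (P : Subgroup G) (a : MonoidAlgebra k G) :
    conjAlg k x (brauerMap P a) =
      brauerMap (P.map (MulAut.conj x).toMonoidHom) (conjAlg k x a) := by
  classical
  ext g
  rw [coeff_conjAlg, coeff_brauerMap, coeff_brauerMap, coeff_conjAlg]
  exact if_congr (mem_centralizer_conj_iff x g).symm rfl rfl

theorem map_conj_eq_of_mem_normalizer {H : Subgroup G} {x : G}
    (hx : x ∈ Subgroup.normalizer (H : Set G)) : H.map (MulAut.conj x).toMonoidHom = H := by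
  ext g
  rw [Subgroup.mem_normalizer_iff] at hx
  constructor
  · rintro ⟨y, hy, rfl⟩
    exact (hx y).1 hy
  · intro hg
    refine ⟨x⁻¹ * g * x, (hx _).2 (by simpa [mul_assoc] using hg), by simp [mul_assoc]⟩

theorem mem_centralizer_of_mem {P : Subgroup G} {x g : G} (hx : x ∈ P)
    (hg : g ∈ Subgroup.centralizer (P : Set G)) : x * g * x⁻¹ = g := by
  rw [Subgroup.mem_centralizer_iff.1 hg x hx, mul_inv_cancel_right]

theorem brauerMap_conjAlg {P : Subgroup G} {x : G} (hx : x ∈ P) (a : MonoidAlgebra k G) :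
    brauerMap P (conjAlg k x a) = brauerMap P a := by
  ext g
  simp only [coeff_brauerMap, coeff_conjAlg]
  split_ifs with h
  · have := mem_centralizer_of_mem (inv_mem hx) h
    rw [inv_inv] at this
    rw [this]
  · rfl

theorem brauerMap_mem_fixedSubalgebra {P R : Subgroup G} {a : MonoidAlgebra k G}
    (hR : R ≤ Subgroup.normalizer (P : Set G)) (ha : a ∈ fixedSubalgebra k R) :
    brauerMap P a ∈ fixedSubalgebra k R := by
  intro x hx
  rw [conjAlg_brauerMap, map_conj_eq_of_mem_normalizer (hR hx), ha x hx]

theorem groupSubalgebra_centralizer_le (P : Subgroup G) :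
    groupSubalgebra k (Subgroup.centralizer (P : Set G)) ≤ fixedSubalgebra k P := by
  intro a ha
  rw [mem_groupSubalgebra] at ha
  intro x hx
  ext g
  rw [coeff_conjAlg]
  by_cases hg : g ∈ Subgroup.centralizer (P : Set G)
  · have := mem_centralizer_of_mem (inv_mem hx) hg
    rw [inv_inv] at this
    rw [this]
  · have h1 : a.coeff g = 0 := by
      by_contra h; exact hg (ha g h)
    rw [h1]
    by_contra h
    have h2 := ha _ h
    have h3 := mem_centralizer_of_mem hx h2
    have : g = x⁻¹ * g * x := by
      rw [← h3]; group
    exact hg (this ▸ h2)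

/-- For a `p`-group acting on a finite set, an invariant function with values in a vector space of
characteristic `p` has the same sum over the set as over the fixed points. -/
theorem IsPGroup.sum_eq_sum_fixedPoints (p : ℕ) [Fact p.Prime] [CharP k p] {R X M : Type*}
    [Group R] (hR : IsPGroup p R) [AddCommGroup M] [Module k M] (ρ : R →* Equiv.Perm X)
    (s : Finset X) (hs : ∀ r, ∀ x ∈ s, ρ r x ∈ s) (φ : X → M)
    (hφ : ∀ r, ∀ x ∈ s, φ (ρ r x) = φ x) [DecidablePred fun x => ∀ r, ρ r x = x] :
    ∑ x ∈ s, φ x = ∑ x ∈ s with ∀ r, ρ r x = x, φ x := by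
  classical
  let _ : MulAction R X := MulAction.compHom X ρ
  rw [← Finset.sum_fiberwise_of_maps_to (t := s.image φ) (g := φ)
      (fun x hx => Finset.mem_image_of_mem φ hx),
    ← Finset.sum_fiberwise_of_maps_to (s := s.filter _) (t := s.image φ) (g := φ)
      (fun x hx => Finset.mem_image_of_mem φ (Finset.mem_filter.1 hx).1)]
  refine Finset.sum_congr rfl fun v _ => ?_
  rw [Finset.sum_congr rfl (g := fun _ => v) (fun x hx => (Finset.mem_filter.1 hx).2),
    Finset.sum_congr (s₁ := Finset.filter _ (Finset.filter _ s)) rfl (g := fun _ => v)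
      (fun x hx => (Finset.mem_filter.1 hx).2), Finset.sum_const, Finset.sum_const]
  -- Each fibre of `φ` in `s` is stable under the `p`-group, so its cardinality is congruent mod `p`
  -- to its number of fixed points.
  let Y : SubMulAction R X :=
    { carrier := (s.filter (fun x => φ x = v) : Finset X)
      smul_mem' := by
        intro r x hx
        simp only [Finset.coe_filter, Set.mem_ofPred_eq] at hx ⊢
        exact ⟨hs r x hx.1, (hφ r x hx.1).trans hx.2⟩ }
  have hYmem : ∀ x, x ∈ Y ↔ x ∈ s ∧ φ x = v := fun x => by
    change x ∈ ((s.filter (fun x => φ x = v) : Finset X) : Set X) ↔ _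
    simp
  have : Finite Y := Finite.of_injective
    (fun y : Y => (⟨y.1, Finset.mem_filter.2 ((hYmem _).1 y.2)⟩ :
      {x // x ∈ s.filter (fun x => φ x = v)})) (fun a b h => Subtype.ext (congrArg Subtype.val h))
  have hcard := hR.card_modEq_card_fixedPoints Y
  have h1 : Nat.card Y = (s.filter (fun x => φ x = v)).card := by
    rw [← Nat.card_eq_finsetCard]
    exact Nat.card_congr (Equiv.subtypeEquivRight fun x => by rw [hYmem, Finset.mem_filter])
  have h2 : Nat.card (MulAction.fixedPoints R Y) =
      ((s.filter (fun x => ∀ r, ρ r x = x)).filter (fun x => φ x = v)).card := by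
    rw [← Nat.card_eq_finsetCard]
    refine Nat.card_congr
      { toFun := fun y => ⟨y.1.1, ?_⟩
        invFun := fun x => ⟨⟨x.1, ?_⟩, ?_⟩
        left_inv := fun _ => rfl
        right_inv := fun _ => rfl }
    · have h3 := (hYmem _).1 y.1.2
      have h4 := y.2
      simp only [Finset.mem_filter]
      exact ⟨⟨h3.1, fun r => congrArg Subtype.val (h4 r)⟩, h3.2⟩
    · have := x.2
      simp only [Finset.mem_filter] at this
      exact (hYmem _).2 ⟨this.1.1, this.2⟩
    · have := x.2
      simp only [Finset.mem_filter] at this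
      exact fun r => Subtype.ext (this.1.2 r)
  rw [h1, h2] at hcard
  have h5 := (CharP.natCast_eq_natCast k p).2 hcard
  rw [← Nat.cast_smul_eq_nsmul k, h5, Nat.cast_smul_eq_nsmul]

/-- The conjugation action of a subgroup. -/
def conjPerm (P : Subgroup G) : P →* Equiv.Perm G :=
  (MulAut.toPerm G).comp ((MulAut.conj (G := G)).comp P.subtype)

theorem conjPerm_apply (P : Subgroup G) (r : P) (x : G) :
    conjPerm P r x = r * x * (r : G)⁻¹ := rfl

theorem coeff_mul_eq_sum [Fintype G] (a c : MonoidAlgebra k G) (g : G) :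
    (a * c).coeff g = ∑ x, a.coeff x * c.coeff (x⁻¹ * g) := by
  rw [coeff_mul_apply_left]
  exact Finsupp.sum_fintype _ _ (fun _ => zero_mul _)

/-- For `g ∈ C_G(P)` the summand `a_x c_{x⁻¹g}` of the coefficient at `g` does not change when `x`
is conjugated by `P`. Modulo `p` only the fixed `x` contribute, and these are the elements of
`C_G(P)`. -/
theorem brauerMap_mul [Finite G] (p : ℕ) [Fact p.Prime] [CharP k p] {P : Subgroup G}
    (hP : IsPGroup p P) {a c : MonoidAlgebra k G}
    (ha : a ∈ fixedSubalgebra k P) (hc : c ∈ fixedSubalgebra k P) :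
    brauerMap P (a * c) = brauerMap P a * brauerMap P c := by
  classical
  cases nonempty_fintype G
  rw [mem_fixedSubalgebra_iff_coeff] at ha hc
  ext g
  rw [coeff_brauerMap]
  split_ifs with hg
  · rw [coeff_mul_eq_sum, coeff_mul_eq_sum]
    rw [hP.sum_eq_sum_fixedPoints (k := k) p
      (conjPerm P) Finset.univ
      (fun _ _ _ => Finset.mem_univ _), Finset.sum_filter]
    · refine Finset.sum_congr rfl fun x _ => ?_
      have hx : (∀ r : P, conjPerm P r x = x)
          ↔ x ∈ Subgroup.centralizer (P : Set G) := by
        simp [Subgroup.mem_centralizer_iff, mul_inv_eq_iff_eq_mul, conjPerm_apply]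
      rw [if_congr hx rfl rfl, coeff_brauerMap, coeff_brauerMap]
      split_ifs with h1 h2
      · rfl
      · exact absurd (mul_mem (inv_mem h1) hg) h2
      · simp
      · simp
    · intro r x _
      rw [conjPerm_apply, ha r r.2]
      congr 1
      have h2 : (↑r * x * (↑r)⁻¹)⁻¹ * g = r * (x⁻¹ * g) * (r : G)⁻¹ := by
        conv_lhs => rw [← mem_centralizer_of_mem r.2 hg]
        group
      rw [h2, hc r r.2]
  · by_contra h
    exact hg (mem_groupSubalgebra.1 (mul_mem (brauerMap_mem_groupSubalgebra P a)
      (brauerMap_mem_groupSubalgebra P c)) g (Ne.symm h))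

end BrauerMap

/-! ### Primitive idempotents in finite-dimensional algebras. -/

section PrimitiveIdempotents

variable {k A : Type*} [Field k] [Ring A] [Algebra k A]

/-- The powers of `t` generate a descending chain of ideals in the commutative Artinian ring `k[t]`,
which stabilizes. The point is that `t ^ n * q` is then an idempotent (Fitting). -/
theorem exists_pow_eq_pow_mul_commute [FiniteDimensional k A] (t : A) :
    ∃ n, n ≠ 0 ∧ ∃ q ∈ Algebra.adjoin k {t}, t ^ n = t ^ (2 * n) * q ∧ Commute t q := by
  let B := Algebra.adjoin k {t}
  have : IsMulCommutative B := Algebra.isMulCommutative_adjoin k (by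
    intro a ha b hb
    rw [Set.mem_singleton_iff.1 ha, Set.mem_singleton_iff.1 hb])
  have : IsArtinianRing B := IsArtinianRing.of_finite k B
  let s : B := ⟨t, Algebra.self_mem_adjoin_singleton k t⟩
  obtain ⟨n, y, hy⟩ := IsArtinian.exists_pow_succ_smul_dvd s (1 : B)
  simp only [smul_eq_mul, mul_one, Nat.succ_eq_add_one] at hy
  have h (m : ℕ) : s ^ n = s ^ (n + m) * y ^ m := by
    induction m with
    | zero => simp
    | succ m ih =>
      calc s ^ n = s ^ n * s ^ m * y ^ m := by rw [← pow_add]; exact ih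
        _ = s ^ (n + 1) * y * s ^ m * y ^ m := by rw [hy]
        _ = _ := by ring
  have h2 : s ^ (n + 1) = s ^ (2 * (n + 1)) * y ^ (n + 1) := by
    calc s ^ (n + 1) = s ^ n * s := pow_succ _ _
      _ = _ := by rw [h (n + 1)]; ring
  refine ⟨n + 1, by simp, (y ^ (n + 1) : B), (y ^ (n + 1)).2, ?_, ?_⟩
  · simpa [s] using congrArg Subtype.val h2
  · exact congrArg Subtype.val (mul_comm s (y ^ (n + 1)))

namespace IsPrimitiveIdempotentIn

variable {S : Subalgebra k A} {j : A}

theorem mul_self (hj : IsPrimitiveIdempotentIn S j) : j * j = j := hj.2.1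

theorem mul_eq_zero_or_eq (hj : IsPrimitiveIdempotentIn S j) {z : A} (hz : z ∈ S)
    (hzi : z * z = z) (hc : j * z = z * j) : j * z = 0 ∨ j * z = j := by
  obtain ⟨hjS, hjj, -, h⟩ := hj
  have hjj : j * j = j := hjj
  have h1 : j * z * (j * z) = j * z := by
    rw [mul_assoc, ← mul_assoc z, ← hc, mul_assoc, hzi, ← mul_assoc, hjj]
  have h2 : j * (j * z) = j * z := by rw [← mul_assoc, hjj]
  have h3 : j * z * j = j * z := by rw [mul_assoc, ← hc, h2]
  rcases h (j * z) (mul_mem hjS hz) (j - j * z) (sub_mem hjS (mul_mem hjS hz)) h1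
    (by simp only [IsIdempotentElem, mul_sub, sub_mul, hjj, h1, h2, h3, sub_self, sub_zero])
    (by rw [mul_sub, h1, h3, sub_self]) (by rw [sub_mul, h1, h2, sub_self])
    (add_sub_cancel _ _) with h | h
  · exact Or.inl h
  · exact Or.inr (sub_eq_zero.1 h).symm

/-- This is the locality of `jSj`, in a form that avoids corner rings. The Fitting idempotent of `t
= j a j` is `0` or `j` by primitivity; in the first case `t` is nilpotent, in the second it is
invertible in `jSj`. -/
theorem exists_mul_eq [FiniteDimensional k A] (hj : IsPrimitiveIdempotentIn S j) {a : A}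
    (ha : a ∈ S) (h : ¬ IsNilpotent (j * a * j)) : ∃ c ∈ S, j * a * c = j := by
  have hjS := hj.1
  have hjj := hj.mul_self
  set t := j * a * j with ht
  have htS : t ∈ S := mul_mem (mul_mem hjS ha) hjS
  have hjt : j * t = t := by rw [ht, ← mul_assoc, ← mul_assoc, hjj]
  have htj : t * j = t := by rw [ht, mul_assoc, hjj]
  obtain ⟨n, hn, q, hq, hnq, hc⟩ := exists_pow_eq_pow_mul_commute (k := k) t
  have hqS : q ∈ S := Algebra.adjoin_le (Set.singleton_subset_iff.2 htS) hq
  obtain ⟨m, rfl⟩ := Nat.exists_eq_succ_of_ne_zero hn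
  have hjtn : j * t ^ (m + 1) = t ^ (m + 1) := by rw [pow_succ', ← mul_assoc, hjt]
  have htnj : t ^ (m + 1) * j = t ^ (m + 1) := by rw [pow_succ, mul_assoc, htj]
  have hqt : q * t ^ (m + 1) = t ^ (m + 1) * q := (hc.pow_left _).eq.symm
  obtain ⟨z, hz⟩ : ∃ z, z = t ^ (m + 1) * q := ⟨_, rfl⟩
  have hzz : z * z = z := by
    calc z * z = t ^ (m + 1) * (q * t ^ (m + 1)) * q := by simp only [hz, mul_assoc]
      _ = t ^ (m + 1) * t ^ (m + 1) * q * q := by rw [hqt]; simp only [mul_assoc]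
      _ = t ^ (2 * (m + 1)) * q * q := by rw [two_mul, ← pow_add]
      _ = z := by rw [← Nat.succ_eq_add_one, ← hnq, hz]
  have hjz : j * z = z := by rw [hz, ← mul_assoc, hjtn]
  have hzj : z * j = z := by rw [hz, ← hqt, mul_assoc, htnj]
  have hzS : z ∈ S := hz ▸ mul_mem (pow_mem htS _) hqS
  rcases hj.mul_eq_zero_or_eq hzS hzz (hjz.trans hzj.symm) with h0 | h0
  · exfalso
    apply h
    refine ⟨m + 1, ?_⟩
    rw [hjz] at h0
    have h2 : t ^ (m + 1) = t ^ (m + 1) * z := by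
      conv_lhs => rw [← Nat.succ_eq_add_one, hnq, two_mul, pow_add]
      rw [hz, mul_assoc]
    rw [h2, h0, mul_zero]
  · rw [hjz] at h0
    refine ⟨j * (t ^ m * q), mul_mem hjS (mul_mem (pow_mem htS _) hqS), ?_⟩
    rw [← mul_assoc, ← ht, ← mul_assoc, ← pow_succ', ← hz, h0]

/-- If `u` is a sum of two orthogonal idempotents, one of them still fails the additively closed
property `N`; splitting stops because the dimension of `uA` drops. This replaces primitive
decompositions throughout, with `N` a vanishing or a nilpotency condition. -/
theorem exists_of_not [FiniteDimensional k A] (S : Subalgebra k A) (N : A → Prop) (h0 : N 0)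
    (hN : ∀ a ∈ S, ∀ c ∈ S, N a → N c → N (a + c)) {u : A} (hu : u ∈ S) (huu : u * u = u)
    (hNu : ¬ N u) : ∃ j, IsPrimitiveIdempotentIn S j ∧ u * j = j ∧ j * u = j ∧ ¬ N j := by
  induction hn : Module.finrank k (LinearMap.range (LinearMap.mulLeft k u))
    using Nat.strong_induction_on generalizing u with
  | _ n ih =>
  by_cases hp : IsPrimitiveIdempotentIn S u
  · exact ⟨u, hp, huu, huu, hNu⟩
  have hu0 : u ≠ 0 := fun h => hNu (h ▸ h0)
  have key : ∀ i ∈ S, ∀ i' ∈ S, i * i = i → i * i' = 0 → i' * i = 0 → i + i' = u → i' ≠ 0 →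
      ¬ N i → ∃ j, IsPrimitiveIdempotentIn S j ∧ u * j = j ∧ j * u = j ∧ ¬ N j := by
    intro i hi i' hi' hii hii' hi'i hadd hi'0 hNi
    have hui : u * i = i := by rw [← hadd, add_mul, hii, hi'i, add_zero]
    have hiu : i * u = i := by rw [← hadd, mul_add, hii, hii', add_zero]
    have hlt : LinearMap.range (LinearMap.mulLeft k i) <
        LinearMap.range (LinearMap.mulLeft k u) := by
      refine lt_of_le_of_ne ?_ ?_
      · rintro _ ⟨x, rfl⟩
        exact ⟨i * x, by simp [← mul_assoc, hui]⟩
      · intro h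
        have : u ∈ LinearMap.range (LinearMap.mulLeft k i) := by
          rw [h]; exact ⟨u, huu⟩
        obtain ⟨x, hx⟩ := this
        simp only [LinearMap.mulLeft_apply] at hx
        have h1 : i * u = u := by rw [← hx, ← mul_assoc, hii]
        rw [hiu] at h1
        rw [h1] at hadd
        exact hi'0 (by simpa using hadd)
    obtain ⟨j, hj, h1, h2, h3⟩ := ih _ (hn ▸ Submodule.finrank_lt_finrank_of_lt hlt) hi hii hNi rfl
    refine ⟨j, hj, ?_, ?_, h3⟩
    · rw [← h1, ← mul_assoc, hui]
    · rw [← h2, mul_assoc, hiu]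
  simp only [IsPrimitiveIdempotentIn, not_and, not_forall, not_or] at hp
  obtain ⟨i₁, h1, i₂, h2, e1, e2, o1, o2, ha, n1, n2⟩ := hp hu huu hu0
  by_cases hN1 : N i₁
  · have hN2 : ¬ N i₂ := fun h => hNu (ha ▸ hN _ h1 _ h2 hN1 h)
    exact key i₂ h2 i₁ h1 e2 o2 o1 (by rw [add_comm, ha]) n1 hN2
  · exact key i₁ h1 i₂ h2 e1 o1 o2 ha n2 hN1

/-- Only a ring isomorphism is required, since the Galois action on `LG` is not `L`-linear. -/
theorem map {A' : Type*} [Ring A'] [Algebra k A'] {S' : Subalgebra k A'} (Φ : A ≃+* A')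
    (hΦ : ∀ a, Φ a ∈ S' ↔ a ∈ S) (hj : IsPrimitiveIdempotentIn S j) :
    IsPrimitiveIdempotentIn S' (Φ j) := by
  obtain ⟨h1, h2, h3, h4⟩ := hj
  have hid (i : A') (hi : IsIdempotentElem i) : IsIdempotentElem (Φ.symm i) := by
    rw [IsIdempotentElem, ← map_mul, hi]
  refine ⟨(hΦ j).2 h1, ?_, by simpa using h3, ?_⟩
  · rw [IsIdempotentElem, ← map_mul, h2]
  · intro i₁ hi₁ i₂ hi₂ e1 e2 o1 o2 ha
    have := h4 (Φ.symm i₁) ((hΦ _).1 (by simpa using hi₁)) (Φ.symm i₂)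
      ((hΦ _).1 (by simpa using hi₂)) (hid _ e1) (hid _ e2)
      (by rw [← map_mul, o1, map_zero]) (by rw [← map_mul, o2, map_zero])
      (by rw [← map_add, ha, RingEquiv.symm_apply_apply])
    simpa using this

end IsPrimitiveIdempotentIn

end PrimitiveIdempotents

/-! ### Block idempotents, associated idempotents and uniqueness below a pair. -/

section BlockIdempotents

variable {k : Type*} [Field k] {G : Type*} [Group G]

instance MonoidAlgebra.finiteDimensional [Finite G] : FiniteDimensional k (MonoidAlgebra k G) :=
  Module.Finite.equiv (MonoidAlgebra.coeffLinearEquiv (S := k) (M := G) k).symm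

namespace IsBlockIdempotent

variable {H : Subgroup G} {e f : MonoidAlgebra k G}

theorem mul_self (he : IsBlockIdempotent H e) : e * e = e := he.2.1

theorem ne_zero (he : IsBlockIdempotent H e) : e ≠ 0 := he.2.2.1

theorem mem_groupSubalgebra (he : IsBlockIdempotent H e) : e ∈ groupSubalgebra k H :=
  (mem_centerSubalgebra.1 he.1).1

theorem mem_fixedSubalgebra (he : IsBlockIdempotent H e) : e ∈ fixedSubalgebra k H :=
  (mem_centerSubalgebra.1 he.1).2

theorem mul_comm_of_mem (he : IsBlockIdempotent H e) {a : MonoidAlgebra k G}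
    (ha : a ∈ groupSubalgebra k H) : e * a = a * e :=
  commute_of_mem_fixedSubalgebra he.mem_fixedSubalgebra ha

theorem mul_eq_self (he : IsBlockIdempotent H e) {z : MonoidAlgebra k G}
    (hz : z ∈ centerSubalgebra k H) (hzz : z * z = z) (h : e * z ≠ 0) : e * z = e :=
  (IsPrimitiveIdempotentIn.mul_eq_zero_or_eq he hz hzz
    (he.mul_comm_of_mem (mem_centerSubalgebra.1 hz).1)).resolve_left h

theorem eq_of_mul_ne_zero (he : IsBlockIdempotent H e) (hf : IsBlockIdempotent H f)
    (h : e * f ≠ 0) : e = f := by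
  have h1 := he.mul_eq_self hf.1 hf.mul_self h
  rw [he.mul_comm_of_mem hf.mem_groupSubalgebra] at h
  have h2 := hf.mul_eq_self he.1 he.mul_self h
  rw [← h1, he.mul_comm_of_mem hf.mem_groupSubalgebra, h2]

theorem map_ringEquiv {H' : Subgroup G} (Φ : MonoidAlgebra k G ≃+* MonoidAlgebra k G)
    (hg : ∀ a, Φ a ∈ groupSubalgebra k H' ↔ a ∈ groupSubalgebra k H)
    (hf : ∀ a, Φ a ∈ fixedSubalgebra k H' ↔ a ∈ fixedSubalgebra k H)
    (he : IsBlockIdempotent H e) : IsBlockIdempotent H' (Φ e) :=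
  IsPrimitiveIdempotentIn.map Φ
    (fun a => by rw [mem_centerSubalgebra, mem_centerSubalgebra, hg, hf]) he

theorem conj (he : IsBlockIdempotent H e) (x : G) :
    IsBlockIdempotent (H.map (MulAut.conj x).toMonoidHom) (conjAlg k x e) :=
  he.map_ringEquiv (conjAlg k x).toRingEquiv (fun _ => conjAlg_mem_groupSubalgebra x)
    (fun _ => conjAlg_mem_fixedSubalgebra x)

end IsBlockIdempotent

theorem map_conj_centralizer (P : Subgroup G) (x : G) :
    (Subgroup.centralizer (P : Set G)).map (MulAut.conj x).toMonoidHom =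
      Subgroup.centralizer ((P.map (MulAut.conj x).toMonoidHom : Subgroup G) : Set G) := by
  ext g
  rw [mem_centralizer_conj_iff]
  constructor
  · rintro ⟨y, hy, rfl⟩
    simpa [mul_assoc] using hy
  · intro h
    exact ⟨_, h, by simp [mul_assoc]⟩

theorem BrauerPairLE.refl (P : Subgroup G) (e : MonoidAlgebra k G) : BrauerPairLE P e P e :=
  ⟨le_rfl, fun _ _ h => h⟩

theorem BrauerPairLE.map {P P' Q Q' : Subgroup G} {e f : MonoidAlgebra k G}
    (Φ : MonoidAlgebra k G ≃+* MonoidAlgebra k G)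
    (hfix : ∀ a, Φ a ∈ fixedSubalgebra k P' ↔ a ∈ fixedSubalgebra k P)
    (hP : ∀ a, Φ (brauerMap P a) = brauerMap P' (Φ a))
    (hQ : ∀ a, Φ (brauerMap Q a) = brauerMap Q' (Φ a)) (hle : Q' ≤ P')
    (h : BrauerPairLE Q f P e) : BrauerPairLE Q' (Φ f) P' (Φ e) := by
  refine ⟨hle, fun i hi ⟨h1, h2⟩ => ?_⟩
  obtain ⟨i, rfl⟩ := Φ.surjective i
  have hi' : IsPrimitiveIdempotentIn (fixedSubalgebra k P) i := by
    have := hi.map (S' := fixedSubalgebra k P) Φ.symm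
      (fun a => by rw [← hfix, RingEquiv.apply_symm_apply])
    simpa using this
  rw [← hP, ← map_mul, Φ.injective.eq_iff] at h1
  rw [← hP, ne_eq, map_eq_zero_iff Φ Φ.injective] at h2
  obtain ⟨h3, h4⟩ := h.2 i hi' ⟨h1, h2⟩
  refine ⟨?_, ?_⟩
  · rw [← hQ, ← map_mul, h3]
  · rwa [← hQ, ne_eq, map_eq_zero_iff Φ Φ.injective]

theorem BrauerPairLE.conj {P Q : Subgroup G} {e f : MonoidAlgebra k G}
    (h : BrauerPairLE Q f P e) (x : G) :
    BrauerPairLE (Q.map (MulAut.conj x).toMonoidHom) (conjAlg k x f)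
      (P.map (MulAut.conj x).toMonoidHom) (conjAlg k x e) :=
  h.map (conjAlg k x).toRingEquiv (fun _ => conjAlg_mem_fixedSubalgebra x)
    (conjAlg_brauerMap x P) (conjAlg_brauerMap x Q) (Subgroup.map_mono h.1)

theorem IsBrauerPair.conj {p : ℕ} {P : Subgroup G} {e : MonoidAlgebra k G}
    (h : IsBrauerPair p P e) (x : G) :
    IsBrauerPair p (P.map (MulAut.conj x).toMonoidHom) (conjAlg k x e) :=
  ⟨h.1.map _, map_conj_centralizer P x ▸ h.2.conj x⟩

theorem block_eq_of_mul_eq {H : Subgroup G} {a e f : MonoidAlgebra k G} (he : IsBlockIdempotent H e)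
    (hf : IsBlockIdempotent H f) (h1 : f * a = a) (h2 : e * a ≠ 0) : e = f := by
  refine he.eq_of_mul_ne_zero hf fun h => h2 ?_
  rw [← h1, ← mul_assoc, h, zero_mul]

variable [Finite G] {p : ℕ} [Fact p.Prime] [CharP k p] {P Q : Subgroup G}
  {e f i : MonoidAlgebra k G}

theorem brauerMap_pow (hP : IsPGroup p P) {t : MonoidAlgebra k G}
    (ht : t ∈ fixedSubalgebra k P) (n : ℕ) : brauerMap P (t ^ n) = brauerMap P t ^ n := by
  induction n with
  | zero => simp [brauerMap_one]
  | succ n ih => rw [pow_succ, pow_succ, brauerMap_mul p hP (pow_mem ht n) ht, ih]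

theorem not_isNilpotent_of_brauerMap (hP : IsPGroup p P) {t : MonoidAlgebra k G}
    (ht : t ∈ fixedSubalgebra k P) (hi : IsIdempotentElem (brauerMap P t))
    (h0 : brauerMap P t ≠ 0) : ¬ IsNilpotent t := by
  rintro ⟨n, hn⟩
  have h1 := brauerMap_pow hP ht (n + 1)
  rw [pow_succ, hn, zero_mul, brauerMap_zero, hi.pow_succ_eq] at h1
  exact h0 h1.symm

theorem brauerMap_idempotent (hP : IsPGroup p P) (hi : i ∈ fixedSubalgebra k P)
    (hii : i * i = i) : brauerMap P i * brauerMap P i = brauerMap P i := by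
  rw [← brauerMap_mul p hP hi hi, hii]

/-- The Brauer map sends `i e i` to the nonzero idempotent `e Br_P(i)`, so `i e i` is not nilpotent
and `i e c = i` for some fixed `c`. Applying `Br_P` shows that `Br_P(i)` is a left multiple of
itself by `e`. -/
theorem IsBrauerPair.isAssociated_of_ne_zero (he : IsBrauerPair p P e)
    (hi : IsPrimitiveIdempotentIn (fixedSubalgebra k P) i) (h : e * brauerMap P i ≠ 0) :
    IsAssociated i P e := by
  have hP := he.1
  have heF := groupSubalgebra_centralizer_le P he.2.mem_groupSubalgebra
  have hBe := brauerMap_of_mem he.2.mem_groupSubalgebra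
  have hBi := brauerMap_idempotent hP hi.1 hi.mul_self
  have hcomm := he.2.mul_comm_of_mem (brauerMap_mem_groupSubalgebra P i)
  have hB : brauerMap P (i * e * i) = e * brauerMap P i := by
    rw [brauerMap_mul p hP (mul_mem hi.1 heF) hi.1, brauerMap_mul p hP hi.1 heF, hBe, ← hcomm,
      mul_assoc, hBi]
  have hid : IsIdempotentElem (e * brauerMap P i) := by
    rw [IsIdempotentElem, mul_assoc, ← mul_assoc (brauerMap P i), ← hcomm, mul_assoc e, hBi,
      ← mul_assoc, he.2.mul_self]
  obtain ⟨c, hc, hic⟩ := hi.exists_mul_eq heF (not_isNilpotent_of_brauerMap hP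
    (mul_mem (mul_mem hi.1 heF) hi.1) (by rwa [hB]) (by rwa [hB]))
  have h2 := congrArg (brauerMap P) hic
  rw [brauerMap_mul p hP (mul_mem hi.1 heF) hc, brauerMap_mul p hP hi.1 heF, hBe, ← hcomm] at h2
  refine ⟨?_, fun h0 => h (by rw [h0, mul_zero])⟩
  rw [← h2, ← mul_assoc, ← mul_assoc, he.2.mul_self]

theorem IsBrauerPair.exists_isAssociated_of_ne_zero (he : IsBrauerPair p P e)
    (hi : i ∈ fixedSubalgebra k P) (hii : i * i = i) (h : e * brauerMap P i ≠ 0) :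
    ∃ j, IsPrimitiveIdempotentIn (fixedSubalgebra k P) j ∧ i * j = j ∧ j * i = j ∧
      IsAssociated j P e := by
  obtain ⟨j, hj, h1, h2, h3⟩ := IsPrimitiveIdempotentIn.exists_of_not (fixedSubalgebra k P)
    (fun a => e * brauerMap P a = 0) (by simp [brauerMap_zero])
    (fun a _ c _ ha hc => by rw [brauerMap_add, mul_add, ha, hc, add_zero]) hi hii h
  exact ⟨j, hj, h1, h2, he.isAssociated_of_ne_zero hj h3⟩

theorem IsBrauerPair.exists_isAssociated (he : IsBrauerPair p P e) :
    ∃ i, IsPrimitiveIdempotentIn (fixedSubalgebra k P) i ∧ IsAssociated i P e := by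
  obtain ⟨j, hj, -, -, h⟩ := he.exists_isAssociated_of_ne_zero (one_mem _) (one_mul 1)
    (by rw [brauerMap_one, mul_one]; exact he.2.ne_zero)
  exact ⟨j, hj, h⟩

theorem exists_block_mul_ne_zero (H : Subgroup G) {a : MonoidAlgebra k G} (ha : a ≠ 0) :
    ∃ f : MonoidAlgebra k G, IsBlockIdempotent H f ∧ f * a ≠ 0 := by
  obtain ⟨j, hj, -, -, h3⟩ := IsPrimitiveIdempotentIn.exists_of_not (centerSubalgebra k H)
    (fun c => c * a = 0) (by simp)
    (fun x _ y _ hx hy => by rw [add_mul, hx, hy, add_zero]) (one_mem _) (one_mul 1)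
    (by simpa using ha)
  exact ⟨j, hj, h3⟩

/-- For any `i` associated to `(P, e)`, the nonzero element `Br_Q(i)` lies in both blocks, and
distinct blocks are orthogonal. -/
theorem IsBrauerPair.block_unique (he : IsBrauerPair p P e) {f' : MonoidAlgebra k G}
    (hf : IsBlockIdempotent (Subgroup.centralizer (Q : Set G)) f)
    (hf' : IsBlockIdempotent (Subgroup.centralizer (Q : Set G)) f')
    (h : BrauerPairLE Q f P e) (h' : BrauerPairLE Q f' P e) : f = f' := by
  obtain ⟨i, hi, hie⟩ := he.exists_isAssociated
  have h1 := h.2 i hi hie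
  have h2 := h'.2 i hi hie
  exact block_eq_of_mul_eq hf hf' h2.1 (by rw [h1.1]; exact h1.2)

end BlockIdempotents

/-! ### Existence of a block below a given Brauer pair. -/

section BrauerPairInclusion

variable {k : Type*} [Field k] {G : Type*} [Group G]

theorem IsPGroup.lt_inf_normalizer [Finite G] {p : ℕ} [Fact p.Prime] {Q T : Subgroup G}
    (hT : IsPGroup p T) (h : Q < T) : Q < T ⊓ Subgroup.normalizer (Q : Set G) := by
  have : Group.IsNilpotent T := hT.isNilpotent
  have hlt : Q.subgroupOf T < ⊤ := by
    rw [lt_top_iff_ne_top, ne_eq, Subgroup.subgroupOf_eq_top]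
    exact fun h' => h.not_ge h'
  have h1 := Group.normalizerCondition_of_isNilpotent _ hlt
  refine lt_of_le_of_ne (le_inf h.le Subgroup.le_normalizer) fun heq => h1.not_ge ?_
  intro x hx
  rw [← Subgroup.subgroupOf_normalizer_eq h.le, Subgroup.mem_subgroupOf] at hx
  rw [Subgroup.mem_subgroupOf, heq]
  exact ⟨x.2, hx⟩

theorem brauerMap_mem_centerSubalgebra {Q R : Subgroup G} (hQR : Q ≤ R) {f : MonoidAlgebra k G}
    (hf : f ∈ centerSubalgebra k (Subgroup.centralizer (Q : Set G))) :
    brauerMap R f ∈ centerSubalgebra k (Subgroup.centralizer (R : Set G)) := by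
  rw [mem_centerSubalgebra] at hf ⊢
  refine ⟨brauerMap_mem_groupSubalgebra R f, brauerMap_mem_fixedSubalgebra ?_
    (fixedSubalgebra_anti (centralizer_anti hQR) hf.2)⟩
  exact Subgroup.centralizer_le_normalizer _

/-- The conjugation action of a subgroup on the group algebra. -/
noncomputable def conjAlgPerm (T : Subgroup G) : T →* Equiv.Perm (MonoidAlgebra k G) where
  toFun r := (conjAlg k (r : G)).toEquiv
  map_one' := by ext1 a; exact conjAlg_one a
  map_mul' x y := by ext1 a; exact conjAlg_mul (x : G) y a

theorem conjAlgPerm_apply (T : Subgroup G) (r : T) (a : MonoidAlgebra k G) :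
    conjAlgPerm T r a = conjAlg k (r : G) a := rfl

open Classical in
/-- The set of `R`-conjugates of an element of the group algebra. -/
noncomputable def conjOrbit [Finite G] (R : Subgroup G) (f : MonoidAlgebra k G) :
    Finset (MonoidAlgebra k G) :=
  (Set.finite_range fun r : R => conjAlg k (r : G) f).toFinset

section Orbit

variable [Finite G] {Q R T : Subgroup G} {f f' : MonoidAlgebra k G}

theorem mem_conjOrbit : f' ∈ conjOrbit R f ↔ ∃ r ∈ R, conjAlg k r f = f' := by
  simp [conjOrbit]

theorem self_mem_conjOrbit : f ∈ conjOrbit R f :=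
  mem_conjOrbit.2 ⟨1, one_mem _, conjAlg_one f⟩

theorem conjAlg_mem_conjOrbit {r : G} (hr : r ∈ R) (h : f' ∈ conjOrbit R f) :
    conjAlg k r f' ∈ conjOrbit R f := by
  obtain ⟨s, hs, rfl⟩ := mem_conjOrbit.1 h
  exact mem_conjOrbit.2 ⟨r * s, mul_mem hr hs, conjAlg_mul r s f⟩

theorem sum_conjOrbit_mem_fixedSubalgebra :
    ∑ c ∈ conjOrbit R f, c ∈ fixedSubalgebra k R := by
  intro r hr
  rw [map_sum]
  refine Finset.sum_bij (fun c _ => conjAlg k r c) (fun c hc => conjAlg_mem_conjOrbit hr hc)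
    (fun a _ c _ h => (conjAlg k r).injective h) ?_ (fun _ _ => rfl)
  intro c hc
  exact ⟨conjAlg k r⁻¹ c, conjAlg_mem_conjOrbit (inv_mem hr) hc, conjAlg_conjAlg_inv r c⟩

theorem IsBlockIdempotent.of_mem_conjOrbit
    (hf : IsBlockIdempotent (Subgroup.centralizer (Q : Set G)) f)
    (hR : R ≤ Subgroup.normalizer (Q : Set G)) (h : f' ∈ conjOrbit R f) :
    IsBlockIdempotent (Subgroup.centralizer (Q : Set G)) f' := by
  obtain ⟨r, hr, rfl⟩ := mem_conjOrbit.1 h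
  have := hf.conj r
  rwa [map_conj_centralizer, map_conj_eq_of_mem_normalizer (hR hr)] at this

theorem sum_conjOrbit_mem_centerSubalgebra
    (hf : IsBlockIdempotent (Subgroup.centralizer (Q : Set G)) f)
    (hR : R ≤ Subgroup.normalizer (Q : Set G)) :
    ∑ c ∈ conjOrbit R f, c ∈ centerSubalgebra k (Subgroup.centralizer (Q : Set G)) :=
  sum_mem fun _ hc => (hf.of_mem_conjOrbit hR hc).1

theorem mul_sum_conjOrbit
    (hf : IsBlockIdempotent (Subgroup.centralizer (Q : Set G)) f)
    (hR : R ≤ Subgroup.normalizer (Q : Set G)) (h : f' ∈ conjOrbit R f) :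
    f' * ∑ c ∈ conjOrbit R f, c = f' := by
  rw [Finset.mul_sum, Finset.sum_eq_single_of_mem f' h]
  · exact (hf.of_mem_conjOrbit hR h).mul_self
  · intro c hc hne
    by_contra h0
    exact hne ((hf.of_mem_conjOrbit hR h).eq_of_mul_ne_zero (hf.of_mem_conjOrbit hR hc) h0).symm

theorem sum_conjOrbit_mul_self
    (hf : IsBlockIdempotent (Subgroup.centralizer (Q : Set G)) f)
    (hR : R ≤ Subgroup.normalizer (Q : Set G)) :
    (∑ c ∈ conjOrbit R f, c) * ∑ c ∈ conjOrbit R f, c = ∑ c ∈ conjOrbit R f, c := by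
  conv_lhs => rw [Finset.sum_mul]
  exact Finset.sum_congr rfl fun c hc => mul_sum_conjOrbit hf hR hc

/-- `T` permutes the orbit, and `Br_T(c y)` is constant along `T`-orbits, so only `T`-fixed members
`c` contribute to the Brauer image of the sum. -/
theorem exists_fixed_mem_conjOrbit {p : ℕ} [Fact p.Prime] [CharP k p] (hT : IsPGroup p T)
    (hTR : T ≤ R) {y : MonoidAlgebra k G} (hy : y ∈ fixedSubalgebra k T)
    (h : brauerMap T ((∑ c ∈ conjOrbit R f, c) * y) ≠ 0) :
    ∃ c ∈ conjOrbit R f, c ∈ fixedSubalgebra k T ∧ brauerMap T (c * y) ≠ 0 := by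
  classical
  rw [Finset.sum_mul, brauerMap_sum, hT.sum_eq_sum_fixedPoints (k := k) p (conjAlgPerm T)
    _ (fun r c hc => conjAlg_mem_conjOrbit (hTR r.2) hc)] at h
  · obtain ⟨c, hc, h1⟩ := Finset.exists_ne_zero_of_sum_ne_zero h
    rw [Finset.mem_filter] at hc
    exact ⟨c, hc.1, fun x hx => hc.2 ⟨x, hx⟩, h1⟩
  · intro r c _
    rw [conjAlgPerm_apply]
    conv_lhs => rw [← hy r r.2, ← map_mul]
    exact brauerMap_conjAlg r.2 _

end Orbit

variable [Finite G] {p : ℕ} [Fact p.Prime] [CharP k p] {P Q R : Subgroup G}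
  {e f g i : MonoidAlgebra k G}

theorem IsBrauerPair.mul_brauerMap_eq (hg : IsBrauerPair p R g) (hQR : Q ≤ R)
    (hf : f ∈ centerSubalgebra k (Subgroup.centralizer (Q : Set G))) (hff : f * f = f)
    (hfR : f ∈ fixedSubalgebra k R) (h : g * brauerMap R f ≠ 0) : g * brauerMap R f = g :=
  hg.2.mul_eq_self (brauerMap_mem_centerSubalgebra hQR hf) (brauerMap_idempotent hg.1 hfR hff) h

/-- A primitive idempotent `s` of the `R`-fixed part of `Z(kC_G(Q))` is the sum of an `R`-orbit of
blocks. When `Br_R(s) ≠ 0` the orbit has an `R`-fixed member, hence is a single block. -/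
theorem IsBrauerPair.exists_stable_block (hg : IsBrauerPair p R g) (hQR : Q ≤ R)
    (hR : R ≤ Subgroup.normalizer (Q : Set G)) :
    ∃ f, IsBlockIdempotent (Subgroup.centralizer (Q : Set G)) f ∧ f ∈ fixedSubalgebra k R ∧
      g * brauerMap R f = g := by
  obtain ⟨s, hs, -, -, hsg⟩ := IsPrimitiveIdempotentIn.exists_of_not
    (centerSubalgebra k (Subgroup.centralizer (Q : Set G)) ⊓ fixedSubalgebra k R)
    (fun a => g * brauerMap R a = 0) (by simp [brauerMap_zero])
    (fun a _ c _ ha hc => by rw [brauerMap_add, mul_add, ha, hc, add_zero]) (one_mem _)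
    (one_mul 1) (by rw [brauerMap_one, mul_one]; exact hg.2.ne_zero)
  obtain ⟨hsZ, hsR⟩ := Algebra.mem_inf.1 hs.1
  obtain ⟨f, hf, hfs⟩ := exists_block_mul_ne_zero (Subgroup.centralizer (Q : Set G)) hs.2.2.1
  have hfs := hf.mul_eq_self hsZ hs.mul_self hfs
  have hcomm : ∀ c, IsBlockIdempotent (Subgroup.centralizer (Q : Set G)) c → s * c = c * s :=
    fun c hc => (hc.mul_comm_of_mem (mem_centerSubalgebra.1 hsZ).1).symm
  have hos : (∑ c ∈ conjOrbit R f, c) * s = ∑ c ∈ conjOrbit R f, c := by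
    rw [Finset.sum_mul]
    refine Finset.sum_congr rfl fun c hc => ?_
    obtain ⟨r, hr, rfl⟩ := mem_conjOrbit.1 hc
    conv_lhs => rw [← hsR r hr, ← map_mul, hfs]
  have hso : s * (∑ c ∈ conjOrbit R f, c) = (∑ c ∈ conjOrbit R f, c) * s := by
    rw [Finset.sum_mul, Finset.mul_sum]
    exact Finset.sum_congr rfl fun c hc => hcomm c (hf.of_mem_conjOrbit hR hc)
  have hfo := mul_sum_conjOrbit hf hR (self_mem_conjOrbit (R := R) (f := f))
  have hseq : s = ∑ c ∈ conjOrbit R f, c := by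
    rcases hs.mul_eq_zero_or_eq (z := ∑ c ∈ conjOrbit R f, c) (Algebra.mem_inf.2
      ⟨sum_conjOrbit_mem_centerSubalgebra hf hR, sum_conjOrbit_mem_fixedSubalgebra⟩)
      (sum_conjOrbit_mul_self hf hR) hso with h | h
    · rw [hso, hos] at h
      rw [h, mul_zero] at hfo
      exact absurd hfo.symm hf.ne_zero
    · rw [hso, hos] at h
      exact h.symm
  have hBo : brauerMap R ((∑ c ∈ conjOrbit R f, c) * 1) ≠ 0 := by
    rw [mul_one, ← hseq]
    exact fun h => hsg (by rw [h, mul_zero])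
  obtain ⟨c, hc, hcR, -⟩ := exists_fixed_mem_conjOrbit hg.1 le_rfl (one_mem _) hBo
  obtain ⟨r, hr, rfl⟩ := mem_conjOrbit.1 hc
  have hfR : f ∈ fixedSubalgebra k R := by
    have h1 := hcR r⁻¹ (inv_mem hr)
    rw [conjAlg_inv_conjAlg] at h1
    rw [h1]
    exact hcR
  have hsf : s = f := by
    rcases hs.mul_eq_zero_or_eq (Algebra.mem_inf.2 ⟨hf.1, hfR⟩) hf.mul_self (hcomm f hf)
      with h | h
    · rw [hcomm f hf, hfs] at h
      exact absurd h hf.ne_zero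
    · rw [hcomm f hf, hfs] at h
      exact h.symm
  exact ⟨f, hf, hfR, hg.mul_brauerMap_eq hQR hf.1 hf.mul_self hfR (hsf ▸ hsg)⟩

/-- The element `d` spreads `y` along `P`-conjugacy. Suppose `g` in the support of `y` equals `w g'
w⁻¹` with `w ∈ P` and `g' ∈ C_G(Q)`. Then `w Q w⁻¹` centralizes `g`, so it lies in `Q` by `hy`; thus
`w` normalizes `Q`, and `y` takes the same value at `g` and `g'`. An element of `C_G(P)` in the
support would force `P ≤ Q`, whence `Br_P(d) = 0`. -/
theorem exists_brauerMap_eq_and_brauerMap_eq_zero (hlt : Q < P) {y : MonoidAlgebra k G}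
    (hyQ : y ∈ groupSubalgebra k (Subgroup.centralizer (Q : Set G)))
    (hyR : y ∈ fixedSubalgebra k (P ⊓ Subgroup.normalizer (Q : Set G)))
    (hy : ∀ g, y.coeff g ≠ 0 → ∀ u ∈ P, u * g = g * u → u ∈ Q) :
    ∃ d ∈ fixedSubalgebra k P, brauerMap Q d = y ∧ brauerMap P d = 0 := by
  classical
  rw [mem_groupSubalgebra] at hyQ
  rw [mem_fixedSubalgebra_iff_coeff] at hyR
  have key : ∀ h : G, ∀ u ∈ P, ∀ v ∈ P, y.coeff (u * h * u⁻¹) ≠ 0 →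
      v * h * v⁻¹ ∈ Subgroup.centralizer (Q : Set G) →
      y.coeff (u * h * u⁻¹) = y.coeff (v * h * v⁻¹) := by
    intro h u hu v hv h1 h2
    have hw : u * v⁻¹ ∈ P := mul_mem hu (inv_mem hv)
    have hconj : u * h * u⁻¹ = (u * v⁻¹) * (v * h * v⁻¹) * (u * v⁻¹)⁻¹ := by group
    have hn : u * v⁻¹ ∈ Subgroup.normalizer (Q : Set G) := by
      refine Subgroup.mem_normalizer_fintype fun x hx => hy _ h1 _
        (mul_mem (mul_mem hw (hlt.le hx)) (inv_mem hw)) ?_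
      rw [hconj]
      have h3 := Subgroup.mem_centralizer_iff.1 h2 x hx
      calc u * v⁻¹ * x * (u * v⁻¹)⁻¹ * (u * v⁻¹ * (v * h * v⁻¹) * (u * v⁻¹)⁻¹)
          = u * v⁻¹ * (x * (v * h * v⁻¹)) * (u * v⁻¹)⁻¹ := by group
        _ = u * v⁻¹ * (v * h * v⁻¹ * x) * (u * v⁻¹)⁻¹ := by rw [h3]
        _ = _ := by group
    rw [hconj, hyR _ ⟨hw, hn⟩]
  let D : G → k := fun h =>
    if H : ∃ u ∈ P, y.coeff (u * h * u⁻¹) ≠ 0 then y.coeff (H.choose * h * H.choose⁻¹) else 0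
  have hD : ∀ h, ∀ v ∈ P, v * h * v⁻¹ ∈ Subgroup.centralizer (Q : Set G) →
      D h = y.coeff (v * h * v⁻¹) := by
    intro h v hv hvC
    by_cases H : ∃ u ∈ P, y.coeff (u * h * u⁻¹) ≠ 0
    · simp only [D, dif_pos H]
      exact key h _ H.choose_spec.1 v hv H.choose_spec.2 hvC
    · simp only [D, dif_neg H]
      by_contra h0
      exact H ⟨v, hv, Ne.symm h0⟩
  have hD0 : ∀ h, (∀ v ∈ P, v * h * v⁻¹ ∉ Subgroup.centralizer (Q : Set G)) → D h = 0 := by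
    intro h hh
    have H : ¬ ∃ u ∈ P, y.coeff (u * h * u⁻¹) ≠ 0 :=
      fun ⟨u, hu, hu'⟩ => hh u hu (hyQ _ hu')
    simp only [D, dif_neg H]
  have hD1 : ∀ h ∈ Subgroup.centralizer (Q : Set G), D h = y.coeff h := fun h hh => by
    simpa using hD h 1 (one_mem _) (by simpa using hh)
  refine ⟨.ofCoeff (Finsupp.equivFunOnFinite.symm D), ?_, ?_, ?_⟩
  · rw [mem_fixedSubalgebra_iff_coeff]
    intro x hx h
    simp only [Finsupp.equivFunOnFinite_symm_apply_apply]
    have hconj (v : G) : v * x⁻¹ * (x * h * x⁻¹) * (v * x⁻¹)⁻¹ = v * h * v⁻¹ := by group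
    have hconj' (v : G) : v * x * h * (v * x)⁻¹ = v * (x * h * x⁻¹) * v⁻¹ := by group
    by_cases H : ∃ v ∈ P, v * h * v⁻¹ ∈ Subgroup.centralizer (Q : Set G)
    · obtain ⟨v, hv, hvC⟩ := H
      rw [hD h v hv hvC, hD (x * h * x⁻¹) (v * x⁻¹) (mul_mem hv (inv_mem hx))
        (by rwa [hconj]), hconj]
    · push Not at H
      rw [hD0 h H, hD0 (x * h * x⁻¹)]
      intro v hv hvC
      exact H (v * x) (mul_mem hv hx) (by rwa [hconj'])
  · ext h
    rw [coeff_brauerMap]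
    simp only [Finsupp.equivFunOnFinite_symm_apply_apply]
    split_ifs with hh
    · exact hD1 h hh
    · by_contra h0
      exact hh (hyQ h (Ne.symm h0))
  · ext h
    rw [coeff_brauerMap]
    simp only [Finsupp.equivFunOnFinite_symm_apply_apply,
      MonoidAlgebra.coeff_zero, Finsupp.coe_zero, Pi.zero_apply]
    split_ifs with hh
    · rw [hD1 h (centralizer_anti hlt.le hh)]
      by_contra h0
      exact hlt.not_ge fun u hu => hy h h0 u hu (Subgroup.mem_centralizer_iff.1 hh u hu)
    · rfl

/-- The inductive step for inclusion, with `R = N_P(Q)`. If `Br_Q(i)` were not in `f`, another block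
`f'` would meet it; take `y = o Br_Q(i)` with `o` the `R`-orbit sum of `f'`. Either centralizers in
`R` of the support of `y` are contained in `Q`, and `y` lifts to an element killed by `Br_P`, or
some subgroup `T > Q` of `R` detects both `f` and a conjugate of `f'`. Both cases are contradictory.
-/
theorem isAssociated_of_stable_block (hP : IsPGroup p P) (hlt : Q < P)
    (hi : IsPrimitiveIdempotentIn (fixedSubalgebra k P) i) (hiP : brauerMap P i ≠ 0)
    (hT : ∀ T, Q < T → T ≤ P → ∃ g, IsBrauerPair p T g ∧ IsAssociated i T g)
    (hf : IsBlockIdempotent (Subgroup.centralizer (Q : Set G)) f)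
    (hfR : f ∈ fixedSubalgebra k (P ⊓ Subgroup.normalizer (Q : Set G)))
    (hfi : brauerMap (P ⊓ Subgroup.normalizer (Q : Set G)) (f * i) ≠ 0) :
    IsAssociated i Q f := by
  set R := P ⊓ Subgroup.normalizer (Q : Set G) with hRdef
  have hRP : R ≤ P := inf_le_left
  have hRN : R ≤ Subgroup.normalizer (Q : Set G) := inf_le_right
  have hQR : Q < R := hP.lt_inf_normalizer hlt
  have hR : IsPGroup p R := hP.to_le hRP
  have hQ : IsPGroup p Q := hP.to_le hlt.le
  have hii := hi.mul_self
  have hiQ := fixedSubalgebra_anti hlt.le hi.1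
  have hBii := brauerMap_idempotent hQ hiQ hii
  have hBiC := brauerMap_mem_groupSubalgebra Q i
  have hBiR : brauerMap Q i ∈ fixedSubalgebra k R :=
    brauerMap_mem_fixedSubalgebra hRN (fixedSubalgebra_anti hRP hi.1)
  refine ⟨?_, fun h => hiP (by rw [← brauerMap_brauerMap hlt.le, h, brauerMap_zero])⟩
  by_contra hne
  obtain ⟨f', hf', h1⟩ := exists_block_mul_ne_zero (Subgroup.centralizer (Q : Set G))
    (sub_ne_zero.2 hne)
  have hne' : f' ≠ f := by
    rintro rfl
    rw [mul_sub, ← mul_assoc, hf.mul_self, sub_self] at h1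
    exact h1 rfl
  have hf'i : f' * brauerMap Q i ≠ 0 := by
    intro h
    rw [mul_sub, h, sub_zero, ← mul_assoc, hf'.mul_comm_of_mem hf.mem_groupSubalgebra, mul_assoc,
      h, mul_zero] at h1
    exact h1 rfl
  set o := ∑ c ∈ conjOrbit R f', c with ho
  have hoZ : o ∈ centerSubalgebra k (Subgroup.centralizer (Q : Set G)) :=
    sum_conjOrbit_mem_centerSubalgebra hf' hRN
  have hoo : o * o = o := sum_conjOrbit_mul_self hf' hRN
  have hoR : o ∈ fixedSubalgebra k R := sum_conjOrbit_mem_fixedSubalgebra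
  have hoi : o * brauerMap Q i = brauerMap Q i * o :=
    commute_of_mem_fixedSubalgebra (mem_centerSubalgebra.1 hoZ).2 hBiC
  set y := o * brauerMap Q i with hy
  have hyC : y ∈ groupSubalgebra k (Subgroup.centralizer (Q : Set G)) :=
    mul_mem (mem_centerSubalgebra.1 hoZ).1 hBiC
  have hyR : y ∈ fixedSubalgebra k R := mul_mem hoR hBiR
  have hy0 : y ≠ 0 := by
    intro h
    have h2 : f' * y = f' * brauerMap Q i := by
      rw [hy, ← mul_assoc, mul_sum_conjOrbit hf' hRN self_mem_conjOrbit]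
    exact hf'i (by rw [← h2, h, mul_zero])
  by_cases hcase : ∀ g, y.coeff g ≠ 0 → ∀ u ∈ R, u * g = g * u → u ∈ Q
  · obtain ⟨d, hdP, hdQ, hd0⟩ := exists_brauerMap_eq_and_brauerMap_eq_zero hlt hyC hyR (by
      intro g hg u hu hug
      have hgC := Subgroup.mem_centralizer_iff.1 (mem_groupSubalgebra.1 hyC g hg)
      -- The case assumption concerns centralizers in `R` only. If `T = C_P(g)` were larger than
      -- `Q`, then `N_T(Q) ≤ R` would be larger too, so the bound extends to `P`.
      let T := P ⊓ Subgroup.centralizer {g}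
      have hmemT (x : G) : x ∈ T ↔ x ∈ P ∧ x * g = g * x := by
        simp [T, Subgroup.mem_inf, Subgroup.mem_centralizer_iff, eq_comm]
      have hQT : Q ≤ T := fun x hx => (hmemT x).2 ⟨hlt.le hx, hgC x hx⟩
      by_contra huQ
      have hQT' : Q < T := lt_of_le_of_ne hQT fun h => huQ (h ▸ (hmemT u).2 ⟨hu, hug⟩)
      have hgrow := (hP.to_le (inf_le_left : T ≤ P)).lt_inf_normalizer hQT'
      refine hgrow.not_ge fun x hx => ?_
      have hxT := (hmemT x).1 hx.1
      exact hcase g hg x ⟨hxT.1, hx.2⟩ hxT.2)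
    have hdiQ := fixedSubalgebra_anti hlt.le hdP
    have hyi : y * brauerMap Q i = y := by rw [hy, mul_assoc, hBii]
    have hiy : brauerMap Q i * y = y := by rw [hoi, ← mul_assoc, hBii]
    have hyy : y * y = y := by
      calc y * y = o * (brauerMap Q i * y) := mul_assoc o _ y
        _ = o * o * brauerMap Q i := by rw [hiy, hy, mul_assoc]
        _ = y := by rw [hoo]
    have hB : brauerMap Q (i * d * i) = y := by
      rw [brauerMap_mul p hQ (mul_mem hiQ hdiQ) hiQ, brauerMap_mul p hQ hiQ hdiQ, hdQ, hiy, hyi]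
    -- `Br_Q(i d i) = y` is a nonzero idempotent, so `i` is a multiple of `i d`; but `Br_P(d) = 0`.
    obtain ⟨c, hc, hidc⟩ := hi.exists_mul_eq hdP (not_isNilpotent_of_brauerMap hQ
      (mul_mem (mul_mem hiQ hdiQ) hiQ) (by rw [hB]; exact hyy) (by rwa [hB]))
    apply hiP
    rw [← hidc, brauerMap_mul p hP (mul_mem hi.1 hdP) hc, brauerMap_mul p hP hi.1 hdP, hd0,
      mul_zero, zero_mul]
  · push Not at hcase
    obtain ⟨g, hg, u, hu, hug, huQ⟩ := hcase
    have hgC := Subgroup.mem_centralizer_iff.1 (mem_groupSubalgebra.1 hyC g hg)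
    let T := R ⊓ Subgroup.centralizer {g}
    have hmemT (x : G) : x ∈ T ↔ x ∈ R ∧ x * g = g * x := by
      simp [T, Subgroup.mem_inf, Subgroup.mem_centralizer_iff, eq_comm]
    have hQT : Q < T := lt_of_le_of_ne (fun x hx => (hmemT x).2 ⟨hQR.le hx, hgC x hx⟩)
      fun h => huQ (h ▸ (hmemT u).2 ⟨hu, hug⟩)
    have hTR : T ≤ R := inf_le_left
    have hTp : IsPGroup p T := hR.to_le hTR
    have hByT : brauerMap T y ≠ 0 := by
      intro h
      have h2 := congrArg (fun a => a.coeff g) h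
      have h3 : g ∈ Subgroup.centralizer (T : Set G) :=
        Subgroup.mem_centralizer_iff.2 fun x hx => ((hmemT x).1 hx).2
      simp only [coeff_brauerMap, if_pos h3] at h2
      exact hg h2
    have hiT := fixedSubalgebra_anti (hTR.trans hRP) hi.1
    -- Since `Br_T(i)` lies in a single block `c`, both `Br_T(f)` and `Br_T(f₂)` act as the identity
    -- on `c`. Hence `f f₂ ≠ 0`, so `f = f₂` is conjugate to `f'` under `R`, which fixes `f`.
    obtain ⟨f₂, hf₂, hf₂T, hB₂⟩ := exists_fixed_mem_conjOrbit hTp hTR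
      (fixedSubalgebra_anti hTR hBiR) hByT
    have hf₂b := hf'.of_mem_conjOrbit hRN hf₂
    obtain ⟨c, hc, hci, hi0⟩ := hT T hQT (hTR.trans hRP)
    rw [brauerMap_mul p hTp hf₂T (fixedSubalgebra_anti hTR hBiR), brauerMap_brauerMap hQT.le] at hB₂
    have hfT := fixedSubalgebra_anti hTR hfR
    have hBf : brauerMap T f * brauerMap T i ≠ 0 := by
      rw [← brauerMap_mul p hTp hfT hiT]
      intro h
      rw [← brauerMap_brauerMap hTR, h, brauerMap_zero] at hfi
      exact hfi rfl
    have hstep (a : MonoidAlgebra k G)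
        (ha : IsBlockIdempotent (Subgroup.centralizer (Q : Set G)) a)
        (haT : a ∈ fixedSubalgebra k T) (h : brauerMap T a * brauerMap T i ≠ 0) :
        c * brauerMap T a = c := by
      refine hc.mul_brauerMap_eq hQT.le ha.1 ha.mul_self haT fun h0 => h ?_
      rw [← hci, ← mul_assoc, ← hc.2.mul_comm_of_mem (brauerMap_mem_groupSubalgebra T a), h0,
        zero_mul]
    have h4 : f = f₂ := by
      refine hf.eq_of_mul_ne_zero hf₂b fun h0 => hc.2.ne_zero ?_
      calc c = c * brauerMap T f * brauerMap T f₂ := by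
            rw [hstep f hf hfT hBf, hstep f₂ hf₂b hf₂T hB₂]
        _ = 0 := by
            rw [mul_assoc, ← brauerMap_mul p hTp hfT hf₂T, h0, brauerMap_zero, mul_zero]
    obtain ⟨r, hr, hrf⟩ := mem_conjOrbit.1 hf₂
    apply hne'
    calc f' = conjAlg k r⁻¹ (conjAlg k r f') := (conjAlg_inv_conjAlg r f').symm
      _ = f := by rw [hrf, ← h4, hfR _ (inv_mem hr)]

/-- Every subgroup of `P` carries a Brauer pair contained in a given Brauer pair `(P, e)`. -/
theorem IsBrauerPair.exists_le (he : IsBrauerPair p P e) (hQP : Q ≤ P) :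
    ∃ f, IsBlockBelow p P e Q f := by
  induction Q using WellFoundedGT.induction with
  -- Descending induction: `ih` covers the subgroups properly containing `Q`, in particular
  -- `N_P(Q)`.
  | ind Q ih =>
  rcases hQP.eq_or_lt with rfl | hlt
  · exact ⟨e, he, BrauerPairLE.refl _ _⟩
  have hP := he.1
  have hQR := hP.lt_inf_normalizer hlt
  obtain ⟨g, hg, hge⟩ := ih _ hQR inf_le_left
  obtain ⟨f, hf, hfR, hgf⟩ := hg.exists_stable_block hQR.le inf_le_right
  refine ⟨f, ⟨hP.to_le hQP, hf⟩, hQP, fun i hi hie => ?_⟩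
  refine isAssociated_of_stable_block hP hlt hi hie.2 (fun T hQT hTP => ?_) hf hfR ?_
  · obtain ⟨c, hc, hce⟩ := ih T hQT hTP
    exact ⟨c, hc, hce.2 i hi hie⟩
  · obtain ⟨h1, h2⟩ := hge.2 i hi hie
    rw [brauerMap_mul p hg.1 hfR (fixedSubalgebra_anti inf_le_left hi.1), ← h1, ← mul_assoc,
      ← hg.2.mul_comm_of_mem (brauerMap_mem_groupSubalgebra _ f), hgf, h1]
    exact h2

end BrauerPairInclusion

theorem map_conj_map_conj {G : Type*} [Group G] (P : Subgroup G) (x y : G) :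
    (P.map (MulAut.conj y).toMonoidHom).map (MulAut.conj x).toMonoidHom =
      P.map (MulAut.conj (x * y)).toMonoidHom := by
  rw [Subgroup.map_map, map_mul]
  rfl

theorem map_conj_one {G : Type*} [Group G] (P : Subgroup G) :
    P.map (MulAut.conj (1 : G)).toMonoidHom = P := by
  rw [map_one]
  exact Subgroup.map_id P

theorem card_map_conj {G : Type*} [Group G] (P : Subgroup G) (x : G) :
    Nat.card (P.map (MulAut.conj x).toMonoidHom) = Nat.card P :=
  Subgroup.card_map_of_injective (MulAut.conj x).injective

/-! ### The relative trace and its Brauer image. -/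

section RelativeTrace

variable {k : Type*} [Field k] {G : Type*} [Group G] {D : Subgroup G}

/-- The relative trace `Tr_D^G`. -/
noncomputable def relTrace (D : Subgroup G) [Fintype (G ⧸ D)] (a : MonoidAlgebra k G) :
    MonoidAlgebra k G :=
  ∑ q : G ⧸ D, conjAlg k q.out a

theorem conjAlg_out_mk {a : MonoidAlgebra k G} (ha : a ∈ fixedSubalgebra k D) (g : G) :
    conjAlg k (QuotientGroup.mk g : G ⧸ D).out a = conjAlg k g a := by
  obtain ⟨h, hh⟩ := QuotientGroup.mk_out_eq_mul D g
  rw [hh, conjAlg_mul, ha h h.2]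

theorem conjAlg_smul_out {a : MonoidAlgebra k G} (ha : a ∈ fixedSubalgebra k D) (g : G)
    (q : G ⧸ D) : conjAlg k (g • q).out a = conjAlg k g (conjAlg k q.out a) := by
  rw [← conjAlg_mul, ← conjAlg_out_mk ha (g * q.out)]
  congr 2
  conv_lhs => rw [← QuotientGroup.out_eq' q]
  rfl

variable [Fintype (G ⧸ D)]

theorem relTrace_mem_fixedSubalgebra {a : MonoidAlgebra k G} (ha : a ∈ fixedSubalgebra k D) :
    relTrace D a ∈ fixedSubalgebra k (⊤ : Subgroup G) := by
  intro x _
  rw [relTrace, map_sum]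
  exact Fintype.sum_equiv (MulAction.toPerm x) _ _ fun q => (conjAlg_smul_out ha x q).symm

theorem relTrace_add (a c : MonoidAlgebra k G) :
    relTrace D (a + c) = relTrace D a + relTrace D c := by
  simp only [relTrace, map_add, Finset.sum_add_distrib]

theorem relTrace_zero : relTrace D (0 : MonoidAlgebra k G) = 0 := by
  simp [relTrace]

theorem mul_relTrace {z : MonoidAlgebra k G} (hz : z ∈ fixedSubalgebra k (⊤ : Subgroup G))
    (a : MonoidAlgebra k G) : z * relTrace D a = relTrace D (z * a) := by
  simp only [relTrace, Finset.mul_sum, map_mul]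
  exact Finset.sum_congr rfl fun q _ => by rw [hz q.out trivial]

/-- `P` acts on the cosets of `D`, and only fixed cosets survive under `Br_P`; the coset `xD` is
fixed exactly when `P ≤ x D x⁻¹`. -/
theorem exists_conj_of_brauerMap_relTrace {p : ℕ} [Fact p.Prime] [CharP k p] {P : Subgroup G}
    (hP : IsPGroup p P) {a c : MonoidAlgebra k G} (ha : a ∈ fixedSubalgebra k D)
    (h : brauerMap P (relTrace D a) * c ≠ 0) :
    ∃ x : G, P ≤ D.map (MulAut.conj x).toMonoidHom ∧ brauerMap P (conjAlg k x a) * c ≠ 0 := by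
  classical
  rw [relTrace, brauerMap_sum, hP.sum_eq_sum_fixedPoints (k := k) p
    ((MulAction.toPermHom G (G ⧸ D)).comp P.subtype) _ (fun _ _ _ => Finset.mem_univ _),
    Finset.sum_mul] at h
  · obtain ⟨q, hq, h1⟩ := Finset.exists_ne_zero_of_sum_ne_zero h
    refine ⟨q.out, fun u hu => ?_, h1⟩
    have h2 : u • q = q := (Finset.mem_filter.1 hq).2 ⟨u, hu⟩
    have h3 : (QuotientGroup.mk (u * q.out) : G ⧸ D) = QuotientGroup.mk q.out := by
      rw [QuotientGroup.out_eq']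
      conv_rhs => rw [← h2, ← QuotientGroup.out_eq' q]
      rfl
    have h4 := QuotientGroup.eq.1 h3.symm
    exact ⟨_, h4, by simp [mul_assoc]⟩
  · intro u q _
    exact (congrArg (brauerMap P) (conjAlg_smul_out ha (u : G) q)).trans (brauerMap_conjAlg u.2 _)

end RelativeTrace

/-! ### Defect groups and conjugacy of maximal Brauer pairs. -/

section DefectPairs

open MonoidAlgebra

variable {k : Type*} [Field k] {G : Type*} [Group G]

theorem mem_centerSubalgebra_top {a : MonoidAlgebra k G} :
    a ∈ centerSubalgebra k (⊤ : Subgroup G) ↔ a ∈ fixedSubalgebra k (⊤ : Subgroup G) := by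
  rw [mem_centerSubalgebra, groupSubalgebra_top]
  exact and_iff_right trivial

theorem mul_comm_of_mem_fixedSubalgebra_top {z : MonoidAlgebra k G}
    (hz : z ∈ fixedSubalgebra k (⊤ : Subgroup G)) (a : MonoidAlgebra k G) : z * a = a * z :=
  commute_of_mem_fixedSubalgebra hz (by rw [groupSubalgebra_top]; trivial)

theorem IsBlockIdempotent.not_isNilpotent {H : Subgroup G} {b : MonoidAlgebra k G}
    (hb : IsBlockIdempotent H b) : ¬ IsNilpotent b := by
  rintro ⟨n, hn⟩
  have h := (show IsIdempotentElem b from hb.mul_self).pow_succ_eq n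
  rw [pow_succ, hn, zero_mul] at h
  exact hb.ne_zero h.symm

theorem IsPrimitiveIdempotentIn.conj {P : Subgroup G} {j : MonoidAlgebra k G}
    (hj : IsPrimitiveIdempotentIn (fixedSubalgebra k P) j) (x : G) :
    IsPrimitiveIdempotentIn (fixedSubalgebra k (P.map (MulAut.conj x).toMonoidHom))
      (conjAlg k x j) :=
  hj.map (conjAlg k x).toRingEquiv fun _ => conjAlg_mem_fixedSubalgebra x

theorem IsAssociated.conj {P : Subgroup G} {i e : MonoidAlgebra k G} (h : IsAssociated i P e)
    (x : G) : IsAssociated (conjAlg k x i) (P.map (MulAut.conj x).toMonoidHom) (conjAlg k x e) := by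
  rw [IsAssociated, ← conjAlg_brauerMap, ← map_mul, h.1]
  exact ⟨rfl, fun h0 => h.2 ((conjAlg k x).injective (by rw [h0, map_zero]))⟩

theorem IsBrauerPairOf.conj {p : ℕ} {b : MonoidAlgebra k G} {P : Subgroup G} {e : MonoidAlgebra k G}
    (hb : IsBlockIdempotent (⊤ : Subgroup G) b) (h : IsBrauerPairOf p b P e) (x : G) :
    IsBrauerPairOf p b (P.map (MulAut.conj x).toMonoidHom) (conjAlg k x e) := by
  refine ⟨h.1.conj x, ?_⟩
  have hbx : conjAlg k x b = b := mem_centerSubalgebra_top.1 hb.1 x trivial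
  conv_lhs => rw [← hbx, ← conjAlg_brauerMap, ← map_mul, h.2]

variable [Finite G] {p : ℕ} [Fact p.Prime] {b : MonoidAlgebra k G}

/-- Split `b` into its parts on conjugacy classes. In the commutative center a sum of nilpotents is
nilpotent, so some part is not nilpotent after multiplication by `b`, hence invertible in the local
ring `Z(kG)b`. -/
theorem IsBlockIdempotent.exists_conjClass_part (hb : IsBlockIdempotent (⊤ : Subgroup G) b) :
    ∃ x y, b.coeff x ≠ 0 ∧ (∀ g, IsConj x g → y.coeff g = b.coeff x) ∧
      (∀ g, ¬ IsConj x g → y.coeff g = 0) ∧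
      ∃ c ∈ fixedSubalgebra k (⊤ : Subgroup G), b * y * c = b := by
  classical
  cases nonempty_fintype G
  have hbF := mem_centerSubalgebra_top.1 hb.1
  have hbc : ∀ g h, IsConj g h → b.coeff h = b.coeff g := by
    intro g h hgh
    obtain ⟨x, rfl⟩ := isConj_iff.1 hgh
    exact mem_fixedSubalgebra_iff_coeff.1 hbF x trivial g
  let y (C : ConjClasses G) : MonoidAlgebra k G :=
    .ofCoeff (Finsupp.equivFunOnFinite.symm fun g => if ConjClasses.mk g = C then b.coeff g else 0)
  have hyc (C : ConjClasses G) (g : G) :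
      (y C).coeff g = if ConjClasses.mk g = C then b.coeff g else 0 := rfl
  have hyF (C : ConjClasses G) : y C ∈ fixedSubalgebra k (⊤ : Subgroup G) := by
    rw [mem_fixedSubalgebra_iff_coeff]
    intro x _ g
    have h : IsConj g (x * g * x⁻¹) := isConj_iff.2 ⟨x, rfl⟩
    rw [hyc, hyc, hbc _ _ h, ConjClasses.mk_eq_mk_iff_isConj.2 h.symm]
  have hsum : ∑ C, y C = b := by
    ext g
    simp [coeff_sum, Finsupp.finsetSum_apply, hyc]
  obtain ⟨C, hC⟩ : ∃ C, ¬ IsNilpotent (b * y C * b) := by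
    by_contra! hall
    apply hb.not_isNilpotent
    have h1 : ∑ C, b * y C * b = b := by
      rw [← Finset.sum_mul, ← Finset.mul_sum, hsum, hb.mul_self, hb.mul_self]
    rw [← h1]
    exact Commute.isNilpotent_sum (fun C _ => hall C) fun C C' _ _ =>
      mul_comm_of_mem_fixedSubalgebra_top (mul_mem (mul_mem hbF (hyF C)) hbF) _
  obtain ⟨c, hc, hbyc⟩ := IsPrimitiveIdempotentIn.exists_mul_eq hb
    (mem_centerSubalgebra_top.2 (hyF C)) hC
  have hy0 : y C ≠ 0 := by
    intro h
    rw [h, mul_zero, zero_mul] at hbyc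
    exact hb.ne_zero hbyc.symm
  obtain ⟨x, hx⟩ : ∃ x, (y C).coeff x ≠ 0 := by
    by_contra! h
    exact hy0 (by ext g; exact h g)
  rw [hyc] at hx
  split_ifs at hx with hxC
  · refine ⟨x, y C, hx, fun g hg => ?_, fun g hg => ?_, c, mem_centerSubalgebra_top.1 hc, hbyc⟩
    · rw [hyc, if_pos (hxC ▸ (ConjClasses.mk_eq_mk_iff_isConj.2 hg.symm)), hbc _ _ hg]
    · rw [hyc, if_neg]
      exact fun h => hg (ConjClasses.mk_eq_mk_iff_isConj.1 (hxC.trans h.symm))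
  · exact absurd rfl hx

theorem natCast_card_ne_zero_of_sylow [CharP k p] (C : Subgroup G) (S : Sylow p C) :
    ((Nat.card {q : G ⧸ (S : Subgroup C).map C.subtype // q.out ∈ C} : ℕ) : k) ≠ 0 := by
  have hmem (c : C) : (c : G) ∈ (S : Subgroup C).map C.subtype ↔ c ∈ (S : Subgroup C) :=
    Subgroup.mem_map_iff_mem C.subtype_injective
  have hbij : Nat.card (C ⧸ (S : Subgroup C)) = Nat.card {q : G ⧸ (S : Subgroup C).map C.subtype //
      q.out ∈ C} := by
    refine Nat.card_congr (Equiv.ofBijective (fun c => ⟨QuotientGroup.mk (c.out : G), ?_⟩) ⟨?_, ?_⟩)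
    · obtain ⟨⟨_, ⟨h, _, rfl⟩⟩, hh⟩ :=
        QuotientGroup.mk_out_eq_mul ((S : Subgroup C).map C.subtype) (c.out : G)
      rw [hh]
      exact mul_mem c.out.2 h.2
    · intro c c' h
      have h1 := QuotientGroup.eq.1 (congrArg Subtype.val h)
      rw [← QuotientGroup.out_eq' c, ← QuotientGroup.out_eq' c']
      exact QuotientGroup.eq.2 ((hmem (c.out⁻¹ * c'.out)).1 h1)
    · rintro ⟨q, hq⟩
      refine ⟨QuotientGroup.mk ⟨q.out, hq⟩, Subtype.ext ?_⟩
      obtain ⟨h, hh⟩ := QuotientGroup.mk_out_eq_mul (S : Subgroup C) ⟨q.out, hq⟩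
      simp only [hh]
      conv_rhs => rw [← QuotientGroup.out_eq' q]
      refine QuotientGroup.eq.2 ?_
      have h3 : ((⟨q.out, hq⟩ * (h : C) : C) : G)⁻¹ * q.out = ((h : C)⁻¹ : C) := by simp
      rw [h3, hmem]
      exact inv_mem h.2
  rw [← hbij, ne_eq, CharP.cast_eq_zero_iff k p]
  exact S.not_dvd_index

/-- `D` is a Sylow `p`-subgroup of `C_G(x)`. The trace of `x` from `D` is the class sum times the
index of `D` in `C_G(x)`, which is invertible in `k`, so the class part of `b` is a trace. As `x` is
in the support of `b` and centralizes `D`, also `Br_D(b) ≠ 0`. -/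
theorem IsBlockIdempotent.exists_eq_relTrace [CharP k p]
    (hb : IsBlockIdempotent (⊤ : Subgroup G) b) :
    ∃ D : Subgroup G, IsPGroup p D ∧ brauerMap D b ≠ 0 ∧
      ∀ _ : Fintype (G ⧸ D), ∃ w ∈ fixedSubalgebra k D, b = relTrace D w := by
  classical
  obtain ⟨x, y, hx, hy, hy', c, hc, hbyc⟩ := hb.exists_conjClass_part
  have hbF := mem_centerSubalgebra_top.1 hb.1
  obtain ⟨S⟩ : Nonempty (Sylow p (Subgroup.centralizer {x})) := inferInstance
  have hcard := natCast_card_ne_zero_of_sylow (k := k) _ S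
  set D := (S : Subgroup (Subgroup.centralizer {x})).map (Subgroup.subtype _) with hD
  have hDC : ∀ u ∈ D, u * x = x * u := by
    rintro _ ⟨u, _, rfl⟩
    exact (Subgroup.mem_centralizer_iff.1 u.2 x rfl).symm
  have hxD : x ∈ Subgroup.centralizer (D : Set G) := Subgroup.mem_centralizer_iff.2 hDC
  have hxF : (single x 1 : MonoidAlgebra k G) ∈ fixedSubalgebra k D :=
    groupSubalgebra_centralizer_le D (single_mem_groupSubalgebra hxD 1)
  refine ⟨D, S.2.map _, ?_, fun _ => ?_⟩
  · intro h
    have h1 := congrArg (fun a => a.coeff x) h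
    simp only [coeff_brauerMap, if_pos hxD] at h1
    exact hx h1
  have ht := relTrace_mem_fixedSubalgebra hxF
  set t := relTrace D (single x 1 : MonoidAlgebra k G) with htdef
  have htc (g : G) : t.coeff g = ∑ q : G ⧸ D, if x = q.out⁻¹ * g * q.out then (1 : k) else 0 := by
    simp [htdef, relTrace, coeff_sum, Finsupp.finsetSum_apply, Finsupp.single_apply]
  have htx : t.coeff x ≠ 0 := by
    rw [htc, Finset.sum_boole]
    convert hcard
    rw [Nat.card_eq_fintype_card, Fintype.card_subtype]
    congr 1
    ext q
    simp only [Finset.mem_filter, Finset.mem_univ, true_and, Subgroup.mem_centralizer_singleton_iff]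
    rw [mul_assoc, eq_inv_mul_iff_mul_eq]
  have ht1 (g : G) (hg : IsConj x g) : t.coeff g = t.coeff x := by
    obtain ⟨u, rfl⟩ := isConj_iff.1 hg
    exact mem_fixedSubalgebra_iff_coeff.1 ht u trivial x
  have ht0 (g : G) (hg : ¬ IsConj x g) : t.coeff g = 0 := by
    rw [htc]
    refine Finset.sum_eq_zero fun q _ => if_neg fun h => hg (isConj_iff.2 ⟨q.out, ?_⟩)
    rw [h]
    group
  have hyt : y = (b.coeff x / t.coeff x) • t := by
    ext g
    rw [coeff_smul_apply]
    by_cases hg : IsConj x g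
    · rw [hy g hg, ht1 g hg, smul_eq_mul, div_mul_cancel₀ _ htx]
    · rw [hy' g hg, ht0 g hg, smul_zero]
  have hz : (b.coeff x / t.coeff x) • (b * c) ∈ fixedSubalgebra k (⊤ : Subgroup G) :=
    Subalgebra.smul_mem _ (mul_mem hbF hc) _
  refine ⟨((b.coeff x / t.coeff x) • (b * c)) * single x 1,
    mul_mem (fixedSubalgebra_anti le_top hz) hxF, ?_⟩
  rw [← mul_relTrace hz, ← htdef]
  conv_lhs => rw [← hbyc, hyt]
  rw [mul_smul_comm, smul_mul_assoc, smul_mul_assoc, mul_assoc, mul_assoc,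
    mul_comm_of_mem_fixedSubalgebra_top ht c]

/-- Refines the trace formula to a primitive idempotent: splitting `b` in `(kG)^D`, some summand `j`
has a trace that is invertible in `Z(kG)b`, and the inverse is absorbed into `w`. -/
theorem IsBlockIdempotent.exists_eq_relTrace_mul [CharP k p]
    (hb : IsBlockIdempotent (⊤ : Subgroup G) b) :
    ∃ D : Subgroup G, IsPGroup p D ∧ ∃ j, IsPrimitiveIdempotentIn (fixedSubalgebra k D) j ∧
      b * j = j ∧ brauerMap D j ≠ 0 ∧
      ∀ _ : Fintype (G ⧸ D), ∃ w ∈ fixedSubalgebra k D, b = relTrace D (w * j) := by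
  obtain ⟨D, hD, hbD, hw⟩ := hb.exists_eq_relTrace (p := p)
  have hbF := mem_centerSubalgebra_top.1 hb.1
  cases nonempty_fintype (G ⧸ D)
  obtain ⟨w, hwD, hbw⟩ := hw inferInstance
  have hF {a : MonoidAlgebra k G} (ha : a ∈ fixedSubalgebra k D) :
      relTrace D (w * a) ∈ fixedSubalgebra k (⊤ : Subgroup G) :=
    relTrace_mem_fixedSubalgebra (mul_mem hwD ha)
  have hb1 : b * relTrace D (w * b) * b = b := by
    rw [← mul_comm_of_mem_fixedSubalgebra_top hbF w, ← mul_relTrace hbF, ← hbw, hb.mul_self,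
      hb.mul_self, hb.mul_self]
  obtain ⟨j, hj, hbj, -, hjN⟩ := IsPrimitiveIdempotentIn.exists_of_not (fixedSubalgebra k D)
    (fun a => IsNilpotent (b * relTrace D (w * a) * b)) (by simp [relTrace_zero])
    (fun a ha c hc h1 h2 => by
      rw [mul_add, relTrace_add, mul_add, add_mul]
      exact Commute.isNilpotent_add
        (mul_comm_of_mem_fixedSubalgebra_top (mul_mem (mul_mem hbF (hF ha)) hbF) _) h1 h2)
    (fixedSubalgebra_anti le_top hbF) hb.mul_self (by rw [hb1]; exact hb.not_isNilpotent)
  obtain ⟨c, hc, hbc⟩ := IsPrimitiveIdempotentIn.exists_mul_eq hb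
    (mem_centerSubalgebra_top.2 (hF hj.1)) hjN
  rw [mem_centerSubalgebra_top] at hc
  have hz : b * c ∈ fixedSubalgebra k (⊤ : Subgroup G) := mul_mem hbF hc
  have hzD := fixedSubalgebra_anti (le_top : D ≤ ⊤) hz
  have hw' : b = relTrace D (b * c * w * j) := by
    rw [mul_assoc (b * c), ← mul_relTrace hz, mul_assoc,
      ← mul_comm_of_mem_fixedSubalgebra_top (hF hj.1), ← mul_assoc, hbc]
  refine ⟨D, hD, j, hj, hbj, ?_, fun inst => ⟨b * c * w, mul_mem hzD hwD, ?_⟩⟩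
  -- `Br_D(b) ≠ 0` gives `D ≤ x D x⁻¹`, an equality by orders, so `Br_D` of the conjugate of `w j`
  -- is a conjugate of `Br_D(w) Br_D(j)`.
  · intro h0
    rw [hw'] at hbD
    obtain ⟨x, hx, h1⟩ := exists_conj_of_brauerMap_relTrace hD (c := 1)
      (mul_mem (mul_mem hzD hwD) hj.1) (by rwa [mul_one])
    have hDx : D = D.map (MulAut.conj x).toMonoidHom := by
      refine Subgroup.eq_of_le_of_card_ge hx ?_
      rw [card_map_conj]
    apply h1
    conv_lhs => rw [hDx]
    rw [← conjAlg_brauerMap, brauerMap_mul p hD (mul_mem hzD hwD) hj.1, h0, mul_zero, map_zero,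
      zero_mul]
  · convert hw'

theorem IsBrauerPair.mul_brauerMap_eq_of_mem_fixedSubalgebra_top [CharP k p] {P : Subgroup G}
    {e z : MonoidAlgebra k G} (he : IsBrauerPair p P e)
    (hz : z ∈ fixedSubalgebra k (⊤ : Subgroup G)) (hzz : z * z = z) (h : e * brauerMap P z ≠ 0) :
    e * brauerMap P z = e :=
  he.2.mul_eq_self (mem_centerSubalgebra.2 ⟨brauerMap_mem_groupSubalgebra P z,
    brauerMap_mem_fixedSubalgebra (Subgroup.centralizer_le_normalizer _)
      (fixedSubalgebra_anti le_top hz)⟩)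
    (brauerMap_idempotent he.1 (fixedSubalgebra_anti le_top hz) hzz) h

/-- Up to conjugation there is a single maximal `(kG, b)`-Brauer pair. -/
theorem IsBlockIdempotent.exists_brauerPair_forall_le [CharP k p]
    (hb : IsBlockIdempotent (⊤ : Subgroup G) b) :
    ∃ (D : Subgroup G) (f : MonoidAlgebra k G), IsBrauerPairOf p b D f ∧
      ∀ (P : Subgroup G) (e : MonoidAlgebra k G), IsBrauerPairOf p b P e →
        ∃ x, BrauerPairLE P e (D.map (MulAut.conj x).toMonoidHom) (conjAlg k x f) := by
  obtain ⟨D, hD, j, hj, hbj, hj0, hw⟩ := hb.exists_eq_relTrace_mul (p := p)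
  have hbF := mem_centerSubalgebra_top.1 hb.1
  have hbD := fixedSubalgebra_anti (le_top : D ≤ ⊤) hbF
  cases nonempty_fintype (G ⧸ D)
  obtain ⟨w, hwD, hbw⟩ := hw inferInstance
  obtain ⟨f, hf, hfj⟩ := exists_block_mul_ne_zero (Subgroup.centralizer (D : Set G)) hj0
  have hfp : IsBrauerPair p D f := ⟨hD, hf⟩
  have hjf := hfp.isAssociated_of_ne_zero hj hfj
  have hbf : f * brauerMap D b = f := by
    refine hfp.mul_brauerMap_eq_of_mem_fixedSubalgebra_top hbF hb.mul_self fun h0 => hfj ?_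
    rw [← hbj, brauerMap_mul p hD hbD hj.1, ← mul_assoc, h0, zero_mul]
  refine ⟨D, f, ⟨hfp, ?_⟩, fun P e he => ?_⟩
  · rw [← hf.mul_comm_of_mem (brauerMap_mem_groupSubalgebra D b), hbf]
  -- Since `b` is a trace from `D`, this places `P` inside some `x D x⁻¹` with `e Br_P(x j x⁻¹) ≠
  -- 0`. The block below `(D, f)^x` at `P` contains `Br_P(x j x⁻¹)`, hence is `e`.
  have h1 : brauerMap P (relTrace D (w * j)) * e ≠ 0 := by
    rw [← hbw, he.2]
    exact he.1.2.ne_zero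
  obtain ⟨x, hx, h2⟩ := exists_conj_of_brauerMap_relTrace he.1.1 (mul_mem hwD hj.1) h1
  have hwP := fixedSubalgebra_anti hx ((conjAlg_mem_fixedSubalgebra x).2 hwD)
  have hjP := fixedSubalgebra_anti hx ((conjAlg_mem_fixedSubalgebra x).2 hj.1)
  rw [map_mul, brauerMap_mul p he.1.1 hwP hjP, mul_assoc] at h2
  obtain ⟨f', hf', hle⟩ := (hfp.conj x).exists_le hx
  have h3 := hle.2 _ (hj.conj x) (hjf.conj x)
  have h4 : e = f' := by
    refine block_eq_of_mul_eq he.1.2 hf'.2 h3.1 fun h0 => h2 ?_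
    rw [← he.1.2.mul_comm_of_mem (brauerMap_mem_groupSubalgebra P _), h0, mul_zero]
  exact ⟨x, h4 ▸ hle⟩

/-- Maximality identifies `(P, e)` with a conjugate of `(D, f)`. The second pair lies in another
conjugate and equals it because `P` and `D` have the same order, so its maximality need not be
assumed. -/
theorem IsMaximalBrauerPairOf.exists_conj_eq [CharP k p] {P : Subgroup G}
    {e e' : MonoidAlgebra k G}
    (hb : IsBlockIdempotent (⊤ : Subgroup G) b) (he : IsMaximalBrauerPairOf p b P e)
    (he' : IsBrauerPairOf p b P e') :
    ∃ g, P.map (MulAut.conj g).toMonoidHom = P ∧ conjAlg k g e = e' := by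
  obtain ⟨D, f, hf, hD⟩ := hb.exists_brauerPair_forall_le (p := p)
  obtain ⟨x, hx⟩ := hD P e he.1
  obtain ⟨h1, h2⟩ := he.2 _ _ (hf.conj hb x) hx
  obtain ⟨y, hy⟩ := hD P e' he'
  have h3 : D.map (MulAut.conj y).toMonoidHom = P := by
    refine (Subgroup.eq_of_le_of_card_ge hy.1 ?_).symm
    rw [← h1, card_map_conj, card_map_conj]
  have hyp := hf.1.conj y
  rw [h3] at hy hyp
  have h4 := hyp.block_unique hyp.2 he'.1.2 (BrauerPairLE.refl _ _) hy
  refine ⟨y * x⁻¹, ?_, ?_⟩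
  · conv_lhs => rw [← h1, map_conj_map_conj, inv_mul_cancel_right, h3]
  · rw [← h2, ← conjAlg_mul, inv_mul_cancel_right, h4]

end DefectPairs

/-! ### Isomorphisms in the fusion system of a block. -/

section FusionIsomorphisms

variable {k : Type*} [Field k] {G : Type*} [Group G]

/-- An idempotent `i` associated to the larger pair satisfies `b i = i`, and its nonzero image
`Br_Q(i)` lies in `f`; so `f Br_Q(b) ≠ 0`. -/
theorem IsBrauerPairOf.of_le [Finite G] {p : ℕ} [Fact p.Prime] [CharP k p]
    {b : MonoidAlgebra k G} (hb : IsBlockIdempotent (⊤ : Subgroup G) b) {P Q : Subgroup G}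
    {e f : MonoidAlgebra k G} (he : IsBrauerPairOf p b P e) (hf : IsBrauerPair p Q f)
    (hle : BrauerPairLE Q f P e) : IsBrauerPairOf p b Q f := by
  have hbF := mem_centerSubalgebra_top.1 hb.1
  have hbP := fixedSubalgebra_anti (le_top : P ≤ ⊤) hbF
  have hbQ := fixedSubalgebra_anti (le_top : Q ≤ ⊤) hbF
  obtain ⟨i, hi, hie⟩ := he.1.exists_isAssociated
  have hif := hle.2 i hi hie
  have hiQ := fixedSubalgebra_anti hle.1 hi.1
  have hcomm := mul_comm_of_mem_fixedSubalgebra_top hbF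
  have hib : i * b = i := by
    refine (hi.mul_eq_zero_or_eq hbP hb.mul_self (hcomm i).symm).resolve_left fun h => hie.2 ?_
    rw [← hcomm] at h
    rw [← hie.1, ← he.2, mul_assoc, hie.1, ← brauerMap_mul p he.1.1 hbP hi.1, h, brauerMap_zero]
  refine ⟨hf, ?_⟩
  rw [← hf.2.mul_comm_of_mem (brauerMap_mem_groupSubalgebra Q b)]
  refine hf.mul_brauerMap_eq_of_mem_fixedSubalgebra_top hbF hb.mul_self fun h0 => hif.2 ?_
  rw [← hif.1, ← hib, ← hcomm, brauerMap_mul p hf.1 hbQ hiQ, ← mul_assoc, h0, zero_mul]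

theorem equiv_map_map_subtype {P : Subgroup G} {g : G} (α : P ≃* P)
    (hα : ∀ u : P, (α u : G) = g * u * g⁻¹) (R : Subgroup P) :
    (R.map α.toMonoidHom).map P.subtype = (R.map P.subtype).map (MulAut.conj g).toMonoidHom := by
  rw [Subgroup.map_map, Subgroup.map_map]
  congr 1
  ext u
  exact hα u

theorem exists_mulEquiv_of_map_conj_eq {P : Subgroup G} {g : G}
    (h : P.map (MulAut.conj g).toMonoidHom = P) :
    ∃ α : P ≃* P, ∀ u : P, (α u : G) = g * u * g⁻¹ :=
  ⟨((MulAut.conj g).subgroupMap P).trans (MulEquiv.subgroupCongr h), fun _ => rfl⟩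

/-- For an isomorphism the two subgroups in the inclusion of pairs coincide, so by uniqueness the
blocks coincide as well. -/
theorem blockFusion_isomorphic_iff [Finite G] {p : ℕ} [Fact p.Prime] [CharP k p]
    {P : Subgroup G} {e : MonoidAlgebra k G} {Q R : Subgroup P} :
    (blockFusion p P e).Isomorphic Q R ↔ ∃ (x : G) (f : MonoidAlgebra k G),
      (Q.map P.subtype).map (MulAut.conj x).toMonoidHom = R.map P.subtype ∧
      IsBlockBelow p P e (Q.map P.subtype) f ∧
      IsBlockBelow p P e (R.map P.subtype) (conjAlg k x f) := by
  constructor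
  · rintro ⟨φ, ⟨x, hx, f, f', hf, hf', hle⟩, -⟩
    have hQR : (Q.map P.subtype).map (MulAut.conj x).toMonoidHom = R.map P.subtype := by
      refine le_antisymm hle.1 ?_
      rintro _ ⟨r, hr, rfl⟩
      obtain ⟨u, hu⟩ := φ.surjective ⟨r, hr⟩
      refine ⟨u, ⟨u, u.2, rfl⟩, ?_⟩
      have h1 := hx u
      simp only [MulEquiv.toMonoidHom_eq_coe, MonoidHom.coe_coe] at h1
      rw [hu] at h1
      exact h1.symm
    refine ⟨x, f, hQR, hf, ?_⟩
    have hfx := hf.1.conj x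
    rw [hQR] at hle hfx
    have h2 := hf'.1.block_unique hfx.2 hf'.1.2 hle (BrauerPairLE.refl _ _)
    rwa [h2]
  · rintro ⟨x, f, hQR, hf, hfx⟩
    have hinj : Function.Injective P.subtype := P.subtype_injective
    let φ : Q ≃* R := (Q.equivMapOfInjective P.subtype hinj).trans
      (((MulAut.conj x).subgroupMap _).trans
        ((MulEquiv.subgroupCongr hQR).trans (R.equivMapOfInjective P.subtype hinj).symm))
    have hφ (u : Q) : ((φ u : P) : G) = x * ((u : P) : G) * x⁻¹ := by
      have h1 : R.equivMapOfInjective P.subtype hinj (φ u) = MulEquiv.subgroupCongr hQR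
          ((MulAut.conj x).subgroupMap _ (Q.equivMapOfInjective P.subtype hinj u)) := by
        exact (R.equivMapOfInjective P.subtype hinj).apply_symm_apply _
      exact congrArg Subtype.val h1
    refine ⟨φ, ⟨x, hφ, f, _, hf, hfx, ?_⟩, ⟨x⁻¹, fun r => ?_, _, f, hfx, hf, ?_⟩⟩
    · rw [hQR]
      exact BrauerPairLE.refl _ _
    · have h1 := hφ (φ.symm r)
      rw [MulEquiv.apply_symm_apply] at h1
      change ((φ.symm r : P) : G) = _
      rw [h1]
      group
    · rw [← hQR, map_conj_map_conj, conjAlg_inv_conjAlg, inv_mul_cancel, map_conj_one]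
      exact BrauerPairLE.refl _ _

end FusionIsomorphisms

/-! ### Invariance under automorphisms of `P`. -/

section CentricSubgroups

variable {P : Type*} [Group P]

theorem centralizer_map_mulEquiv (α : P ≃* P) (R : Subgroup P) :
    Subgroup.centralizer ((R.map α.toMonoidHom : Subgroup P) : Set P) =
      (Subgroup.centralizer (R : Set P)).map α.toMonoidHom := by
  ext g
  obtain ⟨g, rfl⟩ := α.surjective g
  rw [show α g = α.toMonoidHom g from rfl,
    Subgroup.mem_map_iff_mem (f := α.toMonoidHom) α.injective, Subgroup.mem_centralizer_iff,
    Subgroup.mem_centralizer_iff]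
  constructor
  · intro h r hr
    have := h (α r) ⟨r, hr, rfl⟩
    exact α.injective (by simpa using this)
  · rintro h _ ⟨r, hr, rfl⟩
    simpa using congrArg α (h r hr)

theorem centralizer_eq_map_center_iff (R : Subgroup P) :
    Subgroup.centralizer (R : Set P) = (Subgroup.center R).map R.subtype ↔
      Subgroup.centralizer (R : Set P) ≤ R := by
  constructor
  · intro h
    rw [h]
    rintro _ ⟨r, _, rfl⟩
    exact r.2
  · intro h
    ext g
    constructor
    · intro hg
      refine ⟨⟨g, h hg⟩, Subgroup.mem_center_iff.2 fun r => Subtype.ext ?_, rfl⟩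
      exact Subgroup.mem_centralizer_iff.1 hg r r.2
    · rintro ⟨z, hz, rfl⟩
      refine Subgroup.mem_centralizer_iff.2 fun r hr => ?_
      exact congrArg Subtype.val (Subgroup.mem_center_iff.1 hz ⟨r, hr⟩)

namespace SubgroupHoms

variable {F F' : SubgroupHoms P}

theorem fullyCentralized_iff_of_isomorphic (h : ∀ Q R, F.Isomorphic Q R → F'.Isomorphic Q R)
    (h' : ∀ Q R, F'.Isomorphic Q R → ∃ α : P ≃* P, F.Isomorphic Q (R.map α.toMonoidHom))
    (Q : Subgroup P) : F.FullyCentralized Q ↔ F'.FullyCentralized Q := by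
  refine ⟨fun hQ R hR => ?_, fun hQ R hR => hQ R (h _ _ hR)⟩
  obtain ⟨α, hα⟩ := h' _ _ hR
  have h1 := hQ _ hα
  rwa [centralizer_map_mulEquiv, Subgroup.card_map_of_injective (f := α.toMonoidHom)
    α.injective] at h1

theorem fullyNormalized_iff_of_isomorphic (h : ∀ Q R, F.Isomorphic Q R → F'.Isomorphic Q R)
    (h' : ∀ Q R, F'.Isomorphic Q R → ∃ α : P ≃* P, F.Isomorphic Q (R.map α.toMonoidHom))
    (Q : Subgroup P) : F.FullyNormalized Q ↔ F'.FullyNormalized Q := by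
  refine ⟨fun hQ R hR => ?_, fun hQ R hR => hQ R (h _ _ hR)⟩
  obtain ⟨α, hα⟩ := h' _ _ hR
  have h1 := hQ _ hα
  rwa [← Subgroup.map_equiv_normalizer_eq,
    Subgroup.card_map_of_injective (f := α.toMonoidHom) α.injective] at h1

theorem centric_iff_of_isomorphic (h : ∀ Q R, F.Isomorphic Q R → F'.Isomorphic Q R)
    (h' : ∀ Q R, F'.Isomorphic Q R → ∃ α : P ≃* P, F.Isomorphic Q (R.map α.toMonoidHom))
    (Q : Subgroup P) : F.Centric Q ↔ F'.Centric Q := by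
  refine ⟨fun hQ R hR => ?_, fun hQ R hR => hQ R (h _ _ hR)⟩
  obtain ⟨α, hα⟩ := h' _ _ hR
  have h1 := hQ _ hα
  rw [centralizer_eq_map_center_iff, centralizer_map_mulEquiv,
    Subgroup.map_le_map_iff_of_injective (f := α.toMonoidHom) α.injective] at h1
  rwa [centralizer_eq_map_center_iff]

end SubgroupHoms

end CentricSubgroups

/-! ### Galois descent of blocks and Brauer pairs. -/

section GaloisAction

open MonoidAlgebra

theorem coeff_galois_smul {K L G : Type*} [Field K] [Field L] [Algebra K L]
    (σ : L ≃ₐ[K] L) (a : MonoidAlgebra L G) (g : G) :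
    (σ • a).coeff g = σ (a.coeff g) := rfl

theorem exists_finset_orbitSum (K : Type*) {L G : Type*} [Field K] [Field L] [Algebra K L]
    [FiniteDimensional K L] (e : MonoidAlgebra L G) :
    ∃ s : Finset (MonoidAlgebra L G), (∀ c, c ∈ s ↔ ∃ σ : L ≃ₐ[K] L, σ • e = c) ∧
      orbitSum K e = ∑ c ∈ s, c := by
  have hfin : (MulAction.orbit (L ≃ₐ[K] L) e).Finite := Set.finite_range _
  exact ⟨hfin.toFinset, fun c => by simp [MulAction.mem_orbit_iff],
    finsum_mem_eq_finite_toFinset_sum _ hfin⟩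

variable {K L G : Type*} [Field K] [Field L] [Algebra K L] [Group G]

theorem mapRingEquiv_apply_eq_smul (σ : L ≃ₐ[K] L) (a : MonoidAlgebra L G) :
    mapRingEquiv G (σ : L ≃+* L) a = σ • a := by
  ext g
  simp

theorem galois_smul_mul (σ : L ≃ₐ[K] L) (a c : MonoidAlgebra L G) :
    σ • (a * c) = (σ • a) * (σ • c) := by
  simp only [← mapRingEquiv_apply_eq_smul, map_mul]

theorem galois_smul_brauerMap (σ : L ≃ₐ[K] L) (P : Subgroup G) (a : MonoidAlgebra L G) :
    σ • brauerMap P a = brauerMap P (σ • a) := by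
  ext g
  simp only [coeff_brauerMap, coeff_galois_smul]
  split_ifs <;> simp

theorem galois_smul_mem_groupSubalgebra (σ : L ≃ₐ[K] L) {H : Subgroup G}
    {a : MonoidAlgebra L G} : σ • a ∈ groupSubalgebra L H ↔ a ∈ groupSubalgebra L H := by
  simp [mem_groupSubalgebra]

theorem galois_smul_mem_fixedSubalgebra (σ : L ≃ₐ[K] L) {H : Subgroup G}
    {a : MonoidAlgebra L G} : σ • a ∈ fixedSubalgebra L H ↔ a ∈ fixedSubalgebra L H := by
  simp [mem_fixedSubalgebra_iff_coeff]

theorem IsBlockIdempotent.galois_smul {H : Subgroup G} {e : MonoidAlgebra L G}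
    (he : IsBlockIdempotent H e) (σ : L ≃ₐ[K] L) : IsBlockIdempotent H (σ • e) := by
  rw [← mapRingEquiv_apply_eq_smul]
  exact he.map_ringEquiv _
    (fun a => by rw [mapRingEquiv_apply_eq_smul]; exact galois_smul_mem_groupSubalgebra σ)
    (fun a => by rw [mapRingEquiv_apply_eq_smul]; exact galois_smul_mem_fixedSubalgebra σ)

theorem IsBrauerPairOf.galois_smul {p : ℕ} {b : MonoidAlgebra L G} {P : Subgroup G}
    {e : MonoidAlgebra L G} (h : IsBrauerPairOf p b P e) (σ : L ≃ₐ[K] L) :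
    IsBrauerPairOf p (σ • b) P (σ • e) :=
  ⟨⟨h.1.1, h.1.2.galois_smul σ⟩, by rw [← galois_smul_brauerMap, ← galois_smul_mul, h.2]⟩

theorem BrauerPairLE.galois_smul {P Q : Subgroup G} {e f : MonoidAlgebra L G}
    (h : BrauerPairLE Q f P e) (σ : L ≃ₐ[K] L) : BrauerPairLE Q (σ • f) P (σ • e) := by
  simp only [← mapRingEquiv_apply_eq_smul]
  exact h.map _
    (fun a => by rw [mapRingEquiv_apply_eq_smul]; exact galois_smul_mem_fixedSubalgebra σ)
    (fun a => by simp only [mapRingEquiv_apply_eq_smul, galois_smul_brauerMap])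
    (fun a => by simp only [mapRingEquiv_apply_eq_smul, galois_smul_brauerMap]) h.1

variable (K)

theorem coeff_mapRingHom_algebraMap (a : MonoidAlgebra K G) (g : G) :
    (mapRingHom G (algebraMap K L) a).coeff g = algebraMap K L (a.coeff g) := by simp

theorem mapRingHom_algebraMap_injective :
    Function.Injective (mapRingHom G (algebraMap K L)) := by
  intro a c h
  ext g
  have := congrArg (fun d => d.coeff g) h
  simp only [coeff_mapRingHom_algebraMap] at this
  exact (algebraMap K L).injective this

theorem galois_smul_mapRingHom (σ : L ≃ₐ[K] L) (a : MonoidAlgebra K G) :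
    σ • mapRingHom G (algebraMap K L) a = mapRingHom G (algebraMap K L) a := by
  ext g
  simp only [coeff_galois_smul, coeff_mapRingHom_algebraMap, AlgEquiv.commutes]

theorem mapRingHom_conjAlg (x : G) (a : MonoidAlgebra K G) :
    mapRingHom G (algebraMap K L) (conjAlg K x a) =
      conjAlg L x (mapRingHom G (algebraMap K L) a) := by
  ext g
  simp only [coeff_conjAlg, coeff_mapRingHom_algebraMap]

theorem mapRingHom_brauerMap (P : Subgroup G) (a : MonoidAlgebra K G) :
    mapRingHom G (algebraMap K L) (brauerMap P a) =
      brauerMap P (mapRingHom G (algebraMap K L) a) := by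
  ext g
  simp only [coeff_brauerMap, coeff_mapRingHom_algebraMap]
  split_ifs <;> simp

theorem mapRingHom_mem_groupSubalgebra {H : Subgroup G} {a : MonoidAlgebra K G} :
    mapRingHom G (algebraMap K L) a ∈ groupSubalgebra L H ↔ a ∈ groupSubalgebra K H := by
  simp only [mem_groupSubalgebra, coeff_mapRingHom_algebraMap, ne_eq,
    map_eq_zero_iff _ (algebraMap K L).injective]

theorem mapRingHom_mem_fixedSubalgebra {H : Subgroup G} {a : MonoidAlgebra K G} :
    mapRingHom G (algebraMap K L) a ∈ fixedSubalgebra L H ↔ a ∈ fixedSubalgebra K H := by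
  simp only [mem_fixedSubalgebra_iff_coeff, coeff_mapRingHom_algebraMap,
    (algebraMap K L).injective.eq_iff]

theorem mapRingHom_mem_centerSubalgebra {H : Subgroup G} {a : MonoidAlgebra K G} :
    mapRingHom G (algebraMap K L) a ∈ centerSubalgebra L H ↔ a ∈ centerSubalgebra K H := by
  rw [mem_centerSubalgebra, mem_centerSubalgebra, mapRingHom_mem_groupSubalgebra,
    mapRingHom_mem_fixedSubalgebra]

variable [FiniteDimensional K L]

variable {H : Subgroup G} {e : MonoidAlgebra L G}

theorem exists_galois_smul_of_mul_orbitSum {c : MonoidAlgebra L G} (h : c * orbitSum K e ≠ 0) :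
    ∃ σ : L ≃ₐ[K] L, c * (σ • e) ≠ 0 := by
  obtain ⟨s, hs, hsum⟩ := exists_finset_orbitSum K e
  rw [hsum, Finset.mul_sum] at h
  obtain ⟨d, hd, h1⟩ := Finset.exists_ne_zero_of_sum_ne_zero h
  obtain ⟨σ, rfl⟩ := (hs d).1 hd
  exact ⟨σ, h1⟩

theorem orbitSum_mul_eq {c d : MonoidAlgebra L G}
    (h : ∀ σ : L ≃ₐ[K] L, (σ • e) * c = (σ • e) * d) : orbitSum K e * c = orbitSum K e * d := by
  obtain ⟨s, hs, hsum⟩ := exists_finset_orbitSum K e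
  rw [hsum, Finset.sum_mul, Finset.sum_mul]
  refine Finset.sum_congr rfl fun f hf => ?_
  obtain ⟨σ, rfl⟩ := (hs f).1 hf
  exact h σ

/-- As `c` and `d` are Galois-fixed, the relation for `e` holds for each conjugate of `e` and can be
summed. -/
theorem orbitSum_mul_mapRingHom_eq {c d : MonoidAlgebra K G}
    (h : e * mapRingHom G (algebraMap K L) c = e * mapRingHom G (algebraMap K L) d) :
    orbitSum K e * mapRingHom G (algebraMap K L) c =
      orbitSum K e * mapRingHom G (algebraMap K L) d := by
  refine orbitSum_mul_eq K fun σ => ?_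
  rw [← galois_smul_mapRingHom K σ c, ← galois_smul_mapRingHom K σ d, ← galois_smul_mul,
    ← galois_smul_mul, h]

variable {K}

theorem IsBlockIdempotent.mul_orbitSum (he : IsBlockIdempotent H e) : e * orbitSum K e = e := by
  obtain ⟨s, hs, hsum⟩ := exists_finset_orbitSum K e
  have hes : e ∈ s := (hs e).2 ⟨1, one_smul _ e⟩
  rw [hsum, Finset.mul_sum, Finset.sum_eq_single_of_mem e hes, he.mul_self]
  intro c hc hne
  obtain ⟨σ, rfl⟩ := (hs c).1 hc
  by_contra h0
  exact hne (he.eq_of_mul_ne_zero (he.galois_smul σ) h0).symm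

theorem IsBlockIdempotent.orbitSum_mem (he : IsBlockIdempotent H e) :
    orbitSum K e ∈ centerSubalgebra L H := by
  obtain ⟨s, hs, hsum⟩ := exists_finset_orbitSum K e
  rw [hsum]
  refine sum_mem fun c hc => ?_
  obtain ⟨σ, rfl⟩ := (hs c).1 hc
  exact (he.galois_smul σ).1

theorem IsBlockIdempotent.orbitSum_mul_self (he : IsBlockIdempotent H e) :
    orbitSum K e * orbitSum K e = orbitSum K e := by
  conv_rhs => rw [← mul_one (orbitSum K e)]
  refine orbitSum_mul_eq K fun σ => ?_
  rw [mul_one]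
  conv_lhs => rw [← smul_orbitSum K σ e, ← galois_smul_mul, he.mul_orbitSum]

variable [IsGalois K L]

variable (K) in
-- A central idempotent over `K` either kills or fixes `e`, and being Galois-fixed it does the same
-- to all conjugates of `e`. Hence it cannot split the orbit sum.
theorem IsBlockIdempotent.isBlockIdempotent_tilde (he : IsBlockIdempotent H e) :
    IsBlockIdempotent H (tilde K e) := by
  have hinj := mapRingHom_algebraMap_injective (L := L) (G := G) K
  have hid : tilde K e * tilde K e = tilde K e := hinj (by
    rw [map_mul, map_tilde, he.orbitSum_mul_self])
  refine ⟨?_, hid, ?_, ?_⟩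
  · rw [← mapRingHom_mem_centerSubalgebra (L := L) K, map_tilde]
    exact he.orbitSum_mem
  · intro h0
    have h1 := map_tilde K e
    rw [h0, map_zero] at h1
    have h2 := he.mul_orbitSum (K := K)
    rw [← h1, mul_zero] at h2
    exact he.ne_zero h2.symm
  · intro e₁ he₁ e₂ he₂ h1 h2 h12 h21 hadd
    have hz := (mapRingHom_mem_centerSubalgebra (L := L) K).2 he₁
    have hzz : mapRingHom G (algebraMap K L) e₁ * mapRingHom G (algebraMap K L) e₁ =
        mapRingHom G (algebraMap K L) e₁ := by rw [← map_mul, h1]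
    have hte₁ : tilde K e * e₁ = e₁ := by rw [← hadd, add_mul, h1, h21, add_zero]
    rcases IsPrimitiveIdempotentIn.mul_eq_zero_or_eq he hz hzz
      (he.mul_comm_of_mem (mem_centerSubalgebra.1 hz).1) with h | h
    · left
      have h3 := orbitSum_mul_mapRingHom_eq K (c := e₁) (d := 0) (e := e) (by simpa using h)
      rw [← map_tilde, ← map_mul, ← map_mul, mul_zero, hte₁] at h3
      exact hinj h3
    · right
      have h3 := orbitSum_mul_mapRingHom_eq K (c := e₁) (d := 1) (e := e) (by simpa using h)
      rw [← map_tilde, ← map_mul, ← map_mul, mul_one, hte₁] at h3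
      have h4 := hinj h3
      rw [← hadd] at h4
      simpa using h4.symm

theorem IsBlockIdempotent.eq_tilde (he : IsBlockIdempotent H e) {f : MonoidAlgebra K G}
    (hf : IsBlockIdempotent H f) (h : e * mapRingHom G (algebraMap K L) f ≠ 0) :
    f = tilde K e := by
  refine ((he.isBlockIdempotent_tilde K).eq_of_mul_ne_zero hf fun h0 => h ?_).symm
  have h1 := congrArg (mapRingHom G (algebraMap K L)) h0
  rw [map_mul, map_tilde, map_zero] at h1
  rw [← he.mul_orbitSum (K := K), mul_assoc, h1, mul_zero]

theorem IsBrauerPair.isBrauerPair_tilde {p : ℕ} {P : Subgroup G}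
    (he : IsBrauerPair p P e) : IsBrauerPair p P (tilde K e) :=
  ⟨he.1, he.2.isBlockIdempotent_tilde K⟩

variable [Finite G] {p : ℕ} [Fact p.Prime] [CharP K p] [CharP L p] {P Q : Subgroup G}
  {f : MonoidAlgebra L G}

/-- Let `f₀` be the block below `(P, tilde K e)` at `Q` and `i` a primitive idempotent associated to
that pair. Over `L` the idempotent `i` may decompose, but it has a primitive summand `j` associated
to `(P, e)`. Then `Br_Q(j)` lies in both `f` and `f₀`, and `tilde K f` is the only block over `K`
not annihilating `f`. -/
theorem IsBlockBelow.isBlockBelow_tilde (he : IsBrauerPair p P e) (hf : IsBlockBelow p P e Q f) :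
    IsBlockBelow p P (tilde K e) Q (tilde K f) := by
  obtain ⟨f₀, hf₀, hle⟩ := (he.isBrauerPair_tilde (K := K)).exists_le hf.2.1
  suffices h : f₀ = tilde K f from h ▸ ⟨hf₀, hle⟩
  obtain ⟨i, hi, hie⟩ := (he.isBrauerPair_tilde (K := K)).exists_isAssociated
  have hif := hle.2 i hi hie
  have hiP := (mapRingHom_mem_fixedSubalgebra (L := L) K).2 hi.1
  have hii : mapRingHom G (algebraMap K L) i * mapRingHom G (algebraMap K L) i =
      mapRingHom G (algebraMap K L) i := by rw [← map_mul, hi.mul_self]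
  have h0 : e * brauerMap P (mapRingHom G (algebraMap K L) i) ≠ 0 := by
    intro h0
    apply hie.2
    rw [← mapRingHom_brauerMap] at h0
    have h1 := orbitSum_mul_mapRingHom_eq K (c := brauerMap P i) (d := 0) (e := e)
      (by simpa using h0)
    rw [← map_tilde, ← map_mul, hie.1, map_zero, mul_zero] at h1
    exact mapRingHom_algebraMap_injective (L := L) K (h1.trans (map_zero _).symm)
  obtain ⟨j, hj, hij, -, hje⟩ := he.exists_isAssociated_of_ne_zero hiP hii h0
  have hjf := hf.2.2 j hj hje
  have hBj : brauerMap Q (mapRingHom G (algebraMap K L) i) * brauerMap Q j = brauerMap Q j := by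
    rw [← brauerMap_mul p hf.1.1 (fixedSubalgebra_anti hf.2.1 hiP)
      (fixedSubalgebra_anti hf.2.1 hj.1), hij]
  have hfj : mapRingHom G (algebraMap K L) f₀ * brauerMap Q j = brauerMap Q j := by
    rw [← hBj, ← mul_assoc, ← mapRingHom_brauerMap, ← map_mul, hif.1]
  refine hf.1.2.eq_tilde hf₀.2 fun h1 => hjf.2 ?_
  rw [← hjf.1, ← hfj, ← mul_assoc, h1, zero_mul]

theorem isomorphic_tilde_of_isomorphic (he : IsBrauerPair p P e) {Q R : Subgroup P}
    (h : (blockFusion p P e).Isomorphic Q R) :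
    (blockFusion p P (tilde K e)).Isomorphic Q R := by
  rw [blockFusion_isomorphic_iff] at h ⊢
  obtain ⟨x, f, hQR, hf, hfx⟩ := h
  refine ⟨x, tilde K f, hQR, hf.isBlockBelow_tilde he, ?_⟩
  have hconj : conjAlg K x (tilde K f) = tilde K (conjAlg L x f) := by
    have hb := (hf.1.isBrauerPair_tilde (K := K)).2.conj x
    rw [map_conj_centralizer, hQR] at hb
    refine hfx.1.2.eq_tilde hb fun h0 => hf.1.2.ne_zero ((conjAlg L x).injective ?_)
    rw [mapRingHom_conjAlg, map_tilde, ← map_mul, hf.1.2.mul_orbitSum] at h0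
    rw [h0, map_zero]
  rw [hconj]
  exact hfx.isBlockBelow_tilde he

theorem exists_isomorphic_of_isomorphic_tilde {b : MonoidAlgebra L G}
    (hb : IsBlockIdempotent (⊤ : Subgroup G) b) (he : IsMaximalBrauerPairOf p b P e)
    {Q R : Subgroup P} (h : (blockFusion p P (tilde K e)).Isomorphic Q R) :
    ∃ α : P ≃* P, (blockFusion p P e).Isomorphic Q (R.map α.toMonoidHom) := by
  rw [blockFusion_isomorphic_iff] at h
  obtain ⟨x, f', hQR, hf', hfx'⟩ := h
  have hp := he.1.1
  obtain ⟨f, hf⟩ := hp.exists_le hf'.2.1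
  obtain ⟨g, hg⟩ := hp.exists_le hfx'.2.1
  have hfe := (hp.isBrauerPair_tilde (K := K)).block_unique (hf.isBlockBelow_tilde hp).1.2 hf'.1.2 (hf.isBlockBelow_tilde hp).2 hf'.2
  have hge := (hp.isBrauerPair_tilde (K := K)).block_unique (hg.isBlockBelow_tilde hp).1.2 hfx'.1.2 (hg.isBlockBelow_tilde hp).2 hfx'.2
  have hfxp := hf.1.conj x
  rw [hQR] at hfxp
  -- The orbit sums of `x f x⁻¹` and of `g` agree, so the block `x f x⁻¹` meets some conjugate of
  -- `g`.
  obtain ⟨σ, hσ⟩ : ∃ σ : L ≃ₐ[K] L, conjAlg L x f = σ • g := by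
    have h1 : orbitSum K g = conjAlg L x (orbitSum K f) := by
      rw [← map_tilde, ← map_tilde, hge, hfe, mapRingHom_conjAlg]
    have h2 : conjAlg L x f * orbitSum K g ≠ 0 := by
      rw [h1, ← map_mul, hf.1.2.mul_orbitSum]
      exact hfxp.2.ne_zero
    obtain ⟨σ, hσ⟩ := exists_galois_smul_of_mul_orbitSum K h2
    exact ⟨σ, hfxp.2.eq_of_mul_ne_zero (hg.1.2.galois_smul σ) hσ⟩
  have hfb := (he.1.of_le hb hf.1 hf.2).conj hb x
  rw [hQR, hσ] at hfb
  have hgb := (he.1.of_le hb hg.1 hg.2).galois_smul σ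
  -- The same pair `(R, σ g)` belongs to `b` through `x f x⁻¹` and to `σ b` through `g`; orthogonal
  -- blocks cannot share a pair.
  have hbσ : b = σ • b := by
    refine hb.eq_of_mul_ne_zero (hb.galois_smul σ) fun h0 => hfb.1.2.ne_zero ?_
    have hF (c : MonoidAlgebra L G) (hc : IsBlockIdempotent (⊤ : Subgroup G) c) :=
      fixedSubalgebra_anti (le_top : R.map P.subtype ≤ ⊤) (mem_centerSubalgebra_top.1 hc.1)
    rw [← hfb.2]
    conv_lhs => rw [← hgb.2]
    rw [← mul_assoc, ← brauerMap_mul p hfb.1.1 (hF b hb) (hF _ (hb.galois_smul σ)), h0,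
      brauerMap_zero, zero_mul]
  have heσ := he.1.galois_smul σ
  rw [← hbσ] at heσ
  obtain ⟨y, hyP, hye⟩ := he.exists_conj_eq hb heσ
  have hyP' : P.map (MulAut.conj y⁻¹).toMonoidHom = P := by
    conv_lhs => rw [← hyP, map_conj_map_conj, inv_mul_cancel, map_conj_one]
  obtain ⟨α, hα⟩ := exists_mulEquiv_of_map_conj_eq hyP'
  refine ⟨α, blockFusion_isomorphic_iff.2 ⟨y⁻¹ * x, f, ?_, hf, ?_⟩⟩
  · rw [equiv_map_map_subtype α hα, ← hQR, map_conj_map_conj]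
  · rw [equiv_map_map_subtype α hα, conjAlg_mul, hσ]
    refine ⟨hfb.1.conj y⁻¹, ?_⟩
    -- From `(R, σ g) ≤ (P, σ e) = (P, y e y⁻¹)`, conjugation by `y⁻¹` returns to a pair below `(P,
    -- e)`.
    have hle := (hg.2.galois_smul σ).conj y⁻¹
    rwa [hyP', ← hye, conjAlg_inv_conjAlg] at hle

end GaloisAction

theorem proposition6p1 (p : ℕ) [Fact p.Prime]
    {K L : Type*} [Field K] [Field L] [CharP K p] [Algebra K L] [FiniteDimensional K L]
    [IsGalois K L]
    {G : Type*} [Group G] [Finite G]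
    (b : MonoidAlgebra L G) (hb : IsBlockIdempotent (⊤ : Subgroup G) b)
    (P : Subgroup G) (e : MonoidAlgebra L G) (he : IsMaximalBrauerPairOf p b P e)
    (Q : Subgroup P) :
    ((blockFusion p P e).FullyCentralized Q ↔
      (blockFusion p P (tilde K e)).FullyCentralized Q) ∧
    ((blockFusion p P e).FullyNormalized Q ↔
      (blockFusion p P (tilde K e)).FullyNormalized Q) ∧
    ((blockFusion p P e).Centric Q ↔ (blockFusion p P (tilde K e)).Centric Q) := by
  have : CharP L p := charP_of_injective_algebraMap (algebraMap K L).injective p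
  have h : ∀ Q R, (blockFusion p P e).Isomorphic Q R →
      (blockFusion p P (tilde K e)).Isomorphic Q R :=
    fun _ _ => isomorphic_tilde_of_isomorphic he.1.1
  have h' : ∀ Q R, (blockFusion p P (tilde K e)).Isomorphic Q R →
      ∃ α : P ≃* P, (blockFusion p P e).Isomorphic Q (R.map α.toMonoidHom) :=
    fun _ _ => exists_isomorphic_of_isomorphic_tilde hb he
  exact ⟨SubgroupHoms.fullyCentralized_iff_of_isomorphic h h' Q,
    SubgroupHoms.fullyNormalized_iff_of_isomorphic h h' Q,
    SubgroupHoms.centric_iff_of_isomorphic h h' Q⟩
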